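/- Let $1\le p<\infty$. An *abstract real $L^p$ space* is a (real) Banach lattice $\mathcal B$ in which $\|x+y\|^p=\|x\|^p+\|y\|^p$ whenever $|x|\wedge|y|=0$. An *abstract complex $L^p$ space* is an abstract real $L^p$ space $\mathcal B$ together with a norm $\|\cdot\|$ on the complex vector space $\mathcal B_{\mathbb C}=\mathcal B\times\mathcal B$ (with $(x+iy)(v_0,v_1)=(xv_0-yv_1,\,yv_0+xv_1)$, the pair $(v_0,v_1)$ being written $v_0+iv_1$) such that $\|v+i0\|=\|v\|_{\mathcal B}$ for all $v\in\mathcal B$, and $$\|\alpha(v_0+i0)+\beta(v_1+i0)\|^p=|\alpha|^p\|v_0\|_{\mathcal B}^p+|\beta|^p\|v_1\|_{\mathcal B}^p$$ for all $\alpha,\beta\in\mathbb C$ and all $v_0,v_1\in\mathcal B$ with $|v_0|\wedge|v_1|=0$. Two such spaces are *isomorphic* if there is a linear order isomorphism of the underlying real Banach lattices that preserves their norms and whose complexification preserves the norms of the complexifications. Let $\mathcal L_{L^p(\mathbb C)}$ be the language of continuous logic with binary function symbols $\oplus_{s,t}$ and $\wedge_{s,t}$ for all real $s,t$ with $|s|+|t|\le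 1$, a unary function symbol $|\ |$, a unary relation symbol $\|\ \|$, a binary relation symbol $\|\ \|_+$, and a constant symbol $\mathbf 0$; the modulus of continuity is $\varepsilon\mapsto 2\varepsilon$ for each binary symbol and $\varepsilon\mapsto\varepsilon$ for each unary symbol, meaning that the value of the interpreted symbol moves by at most $2\varepsilon$ (respectively $\varepsilon$) when each argument moves by at most $\varepsilon$. Interpretations are complete metric spaces of diameter at most $1$ with uniformly continuous interpretations of the symbols (with values in $[0,1]$ for relation symbols) obeying these moduli. The connectives are all continuous functions $[0,1]^n\to[0,1]$, the quantifiers are $\sup$ and $\inf$, and an interpretation satisfies a sentence if the value of the sentence is $0$. For an abstract complex $L^p$ space $B$ over $\mathcal B$ let $\mathcal A_B$ be the interpretation whose domain is the closed unit ball of $\mathcal B$, with the metric $d(x,y)=\min(\|x-y\|_{\mathcal B},1)$, in which $\oplus_{s,t}(x,y)=sx+ty$, $\wedge_{s,t}(x,y)=(sx)\wedge(ty)$, $|\ |$ is the absolute value, $\|\ \|$ is the norm of $\mathcal B$, $\|(x,y)\|_+=\min(\|x+iy\|,1)$, and $\mathbf 0$ is the zero vector. Then there is a theory (a set of sentences)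 $T_{L^p(\mathbb C)}$ of $\mathcal L_{L^p(\mathbb C)}$ that represents the class of abstract complex $L^p$ spaces, in the following sense: 1. $\mathcal A_B$ is a model of $T_{L^p(\mathbb C)}$ for every abstract complex $L^p$ space $B$. 2. For all abstract complex $L^p$ spaces $B_0,B_1$: $B_0$ is isomorphic to $B_1$ if and only if $\mathcal A_{B_0}$ is isomorphic to $\mathcal A_{B_1}$ (isomorphisms of interpretations are the isometric bijections that preserve all symbols). 3. Every model of $T_{L^p(\mathbb C)}$ embeds (by an isometric map that preserves all symbols) into $\mathcal A_B$ for some abstract complex $L^p$ space $B$. -/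

import Mathlib

universe u w

namespace ContLogic

/-! ### Metric languages, terms and formulas of continuous logic -/

/-- A metric language: function symbols and relation symbols with their arities, constant symbols,
and for each function or relation symbol a modulus `(0, ∞) → (0, ∞)` (given as a map `ℝ → ℝ` that
is positive on positive arguments; its values elsewhere play no role). -/
structure MetricLanguage where
  Fun : ℕ → Type w
  Rel : ℕ → Type w
  Const : Type w
  funModulus : {n : ℕ} → Fun n → ℝ → ℝ
  relModulus : {n : ℕ} → Rel n → ℝ → ℝ
  funModulus_pos : ∀ {n : ℕ} (f : Fun n) (ε : ℝ), 0 < ε → 0 < funModulus f ε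
  relModulus_pos : ∀ {n : ℕ} (R : Rel n) (ε : ℝ), 0 < ε → 0 < relModulus R ε

/-- Terms in the variables `x₀, …, xₙ₋₁`. -/
inductive Term (L : MetricLanguage.{w}) (n : ℕ) : Type w where
  | var (i : Fin n) : Term L n
  | const (c : L.Const) : Term L n
  | app {k : ℕ} (f : L.Fun k) (ts : Fin k → Term L n) : Term L n

/-- Well-formed formulas whose free variables are among `x₀, …, xₙ₋₁`.  Every continuous function
`[0,1]^k → [0,1]` is a connective; the quantifiers `sup` and `inf` bind the last variable. -/
inductive Formula (L : MetricLanguage.{w}) : ℕ → Type w where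
  | dist {n : ℕ} (t₁ t₂ : Term L n) : Formula L n
  | rel {n k : ℕ} (R : L.Rel k) (ts : Fin k → Term L n) : Formula L n
  | conn {n k : ℕ} (c : C(Fin k → unitInterval, unitInterval)) (φs : Fin k → Formula L n) :
      Formula L n
  | sup {n : ℕ} (φ : Formula L (n + 1)) : Formula L n
  | inf {n : ℕ} (φ : Formula L (n + 1)) : Formula L n

/-- A sentence is a formula without free variables. -/
abbrev Sentence (L : MetricLanguage.{w}) : Type w := Formula L 0

/-- A theory is a set of sentences. -/
abbrev Theory (L : MetricLanguage.{w}) : Type w := Set (Sentence L)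

/-! ### Interpretations -/

/-- `Δ` is a modulus of continuity of `f : M^n → N`: if all coordinates move by at most `ε`,
then the value moves by at most `Δ ε`. -/
def HasModulus {M N : Type*} [PseudoMetricSpace M] [PseudoMetricSpace N] {n : ℕ}
    (Δ : ℝ → ℝ) (f : (Fin n → M) → N) : Prop :=
  ∀ ε : ℝ, 0 < ε → ∀ x y : Fin n → M, (∀ i, dist (x i) (y i) ≤ ε) → dist (f x) (f y) ≤ Δ ε

/-- An interpretation of a metric language: a (nonempty) complete metric space of diameter at
most `1`, with uniformly continuous interpretations of the function symbols and of the
(`[0,1]`-valued) relation symbols that obey the moduli of the language, and with interpretations of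
the constants. -/
structure Interpretation (L : MetricLanguage.{w}) where
  carrier : Type u
  [metric : MetricSpace carrier]
  [complete : CompleteSpace carrier]
  [nonempty : Nonempty carrier]
  dist_le_one : ∀ x y : carrier, dist x y ≤ 1
  fn : {n : ℕ} → L.Fun n → (Fin n → carrier) → carrier
  rel : {n : ℕ} → L.Rel n → (Fin n → carrier) → unitInterval
  const : L.Const → carrier
  fn_uniformContinuous : ∀ {n : ℕ} (f : L.Fun n), UniformContinuous (fn f)
  rel_uniformContinuous : ∀ {n : ℕ} (R : L.Rel n), UniformContinuous (rel R)
  fn_modulus : ∀ {n : ℕ} (f : L.Fun n), HasModulus (L.funModulus f) (fn f)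
  rel_modulus : ∀ {n : ℕ} (R : L.Rel n), HasModulus (L.relModulus R) (rel R)

attribute [instance] Interpretation.metric Interpretation.complete Interpretation.nonempty

namespace Interpretation

variable {L : MetricLanguage.{w}}

/-- The value of a term in an interpretation under an assignment. -/
def termValue (M : Interpretation.{u} L) {n : ℕ} (v : Fin n → M.carrier) :
    Term L n → M.carrier
  | .var i => v i
  | .const c => M.const c
  | .app f ts => M.fn f (fun i => M.termValue v (ts i))

/-- The truth value in `[0,1]` of a formula in an interpretation under an assignment. -/
noncomputable def value (M : Interpretation.{u} L) :
    {n : ℕ} → Formula L n → (Fin n → M.carrier) → unitInterval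
  | _, .dist t₁ t₂, v =>
      ⟨dist (M.termValue v t₁) (M.termValue v t₂), dist_nonneg, M.dist_le_one _ _⟩
  | _, .rel R ts, v => M.rel R (fun i => M.termValue v (ts i))
  | _, .conn c φs, v => c (fun i => M.value (φs i) v)
  | _, .sup φ, v => ⨆ x : M.carrier, M.value φ (Fin.snoc v x)
  | _, .inf φ, v => ⨅ x : M.carrier, M.value φ (Fin.snoc v x)

/-- An interpretation satisfies a sentence if the truth value of the sentence is `0`. -/
def Satisfies (M : Interpretation.{u} L) (φ : Sentence L) : Prop :=
  M.value φ Fin.elim0 = 0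

/-- An interpretation is a model of a theory if it satisfies each of its sentences. -/
def IsModel (M : Interpretation.{u} L) (T : Theory L) : Prop :=
  ∀ φ ∈ T, M.Satisfies φ

/-- An (isomorphic) embedding of interpretations: an isometric map that preserves the
interpretations of all symbols. -/
structure Embedding (M N : Interpretation.{u} L) where
  toFun : M.carrier → N.carrier
  isometry : Isometry toFun
  map_fn : ∀ {n : ℕ} (f : L.Fun n) (x : Fin n → M.carrier),
    toFun (M.fn f x) = N.fn f (fun i => toFun (x i))
  map_rel : ∀ {n : ℕ} (R : L.Rel n) (x : Fin n → M.carrier),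
    M.rel R x = N.rel R (fun i => toFun (x i))
  map_const : ∀ c : L.Const, toFun (M.const c) = N.const c

/-- An isomorphism of interpretations is a surjective embedding. -/
structure Iso (M N : Interpretation.{u} L) extends Embedding M N where
  surjective : Function.Surjective toFun

end Interpretation

/-- The theory `T` represents a class `K` of structures, with its notion `IsIso` of isomorphism, by
means of the assignment `B ↦ A B` of an interpretation to each member of the class. -/
def Represents {L : MetricLanguage.{w}} {K : Type*} (IsIso : K → K → Prop) (T : Theory L)
    (A : K → Interpretation.{u} L) : Prop :=
  (∀ B : K, (A B).IsModel T) ∧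
  (∀ B₀ B₁ : K, IsIso B₀ B₁ ↔ Nonempty (Interpretation.Iso (A B₀) (A B₁))) ∧
  (∀ M : Interpretation.{u} L, M.IsModel T →
    ∃ B : K, Nonempty (Interpretation.Embedding M (A B)))

end ContLogic

/-! ### The complexification of a real vector space -/

/-- The underlying set `V × V` of the complexification of `V`; `⟨v₀, v₁⟩` stands for
`v₀ + i v₁`. -/
@[ext]
structure Complexification (V : Type u) where
  re : V
  im : V

namespace Complexification

variable {V : Type u} [AddCommGroup V]

instance : Zero (Complexification V) := ⟨⟨0, 0⟩⟩
instance : Add (Complexification V) := ⟨fun x y => ⟨x.re + y.re, x.im + y.im⟩⟩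
instance : Neg (Complexification V) := ⟨fun x => ⟨-x.re, -x.im⟩⟩

@[simp] theorem zero_re : (0 : Complexification V).re = 0 := rfl
@[simp] theorem zero_im : (0 : Complexification V).im = 0 := rfl
@[simp] theorem add_re (x y : Complexification V) : (x + y).re = x.re + y.re := rfl
@[simp] theorem add_im (x y : Complexification V) : (x + y).im = x.im + y.im := rfl
@[simp] theorem neg_re (x : Complexification V) : (-x).re = -x.re := rfl
@[simp] theorem neg_im (x : Complexification V) : (-x).im = -x.im := rfl

instance : AddCommGroup (Complexification V) where
  add_assoc x y z := by ext <;> simp [add_assoc]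
  zero_add x := by ext <;> simp
  add_zero x := by ext <;> simp
  neg_add_cancel x := by ext <;> simp
  add_comm x y := by ext <;> simp [add_comm]
  nsmul := nsmulRec
  zsmul := zsmulRec

variable [Module ℝ V]

/-- `(x + i y) (v₀, v₁) = (x v₀ - y v₁, y v₀ + x v₁)`. -/
instance : SMul ℂ (Complexification V) :=
  ⟨fun c v => ⟨c.re • v.re - c.im • v.im, c.im • v.re + c.re • v.im⟩⟩

@[simp] theorem smul_re (c : ℂ) (v : Complexification V) :
    (c • v).re = c.re • v.re - c.im • v.im := rfl
@[simp] theorem smul_im (c : ℂ) (v : Complexification V) :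
    (c • v).im = c.im • v.re + c.re • v.im := rfl

instance : Module ℂ (Complexification V) where
  one_smul x := by ext <;> simp
  mul_smul a b x := by
    ext
    · simp only [smul_re, smul_im, Complex.mul_re, Complex.mul_im]; module
    · simp only [smul_re, smul_im, Complex.mul_re, Complex.mul_im]; module
  smul_zero a := by ext <;> simp
  smul_add a x y := by
    ext
    · simp only [smul_re, add_re, add_im]; module
    · simp only [smul_im, add_re, add_im]; module
  add_smul a b x := by
    ext
    · simp only [smul_re, add_re, Complex.add_re, Complex.add_im]; module
    · simp only [smul_im, add_im, Complex.add_re, Complex.add_im]; module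
  zero_smul x := by ext <;> simp

end Complexification

/-! ### Abstract `L^p` spaces -/

/-- An abstract real `L^p` space: a Banach lattice with `‖x + y‖^p = ‖x‖^p + ‖y‖^p` for disjoint
`x`, `y`. -/
structure AbstractRealLp (p : ℝ) where
  carrier : Type u
  [normed : NormedAddCommGroup carrier]
  [space : NormedSpace ℝ carrier]
  [complete : CompleteSpace carrier]
  [lattice : Lattice carrier]
  [ordered : IsOrderedAddMonoid carrier]
  [posSMul : PosSMulMono ℝ carrier]
  [solid : HasSolidNorm carrier]
  norm_add_rpow : ∀ x y : carrier, |x| ⊓ |y| = 0 → ‖x + y‖ ^ p = ‖x‖ ^ p + ‖y‖ ^ p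

attribute [instance] AbstractRealLp.normed AbstractRealLp.space AbstractRealLp.complete
  AbstractRealLp.lattice AbstractRealLp.ordered AbstractRealLp.posSMul AbstractRealLp.solid

/-- An abstract complex `L^p` space: an abstract real `L^p` space `B` together with a norm
`cnorm` (a seminorm over `ℂ` that vanishes only at `0`) on the complexification of `B` that extends
the norm of `B`, and for which disjoint elements of `B` are formally `L^p`-disjointly supported. -/
structure AbstractComplexLp (p : ℝ) extends AbstractRealLp.{u} p where
  cnorm : Seminorm ℂ (Complexification carrier)
  cnorm_definite : ∀ v : Complexification carrier, cnorm v = 0 → v = 0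
  norm_eq_cnorm : ∀ v : carrier, ‖v‖ = cnorm ⟨v, 0⟩
  cnorm_rpow : ∀ v₀ v₁ : carrier, |v₀| ⊓ |v₁| = 0 → ∀ α β : ℂ,
    cnorm (α • ⟨v₀, 0⟩ + β • ⟨v₁, 0⟩) ^ p = ‖α‖ ^ p * ‖v₀‖ ^ p + ‖β‖ ^ p * ‖v₁‖ ^ p

namespace AbstractComplexLp

variable {p : ℝ}

/-- An isomorphism of abstract complex `L^p` spaces: a linear order isomorphism of the underlying
real Banach lattices that preserves the norms of these lattices, and whose complexification
preserves the norms of the complexifications. -/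
structure Iso (B₀ B₁ : AbstractComplexLp.{u} p) where
  toEquiv : B₀.carrier ≃ₗ[ℝ] B₁.carrier
  map_le_map_iff : ∀ x y : B₀.carrier, toEquiv x ≤ toEquiv y ↔ x ≤ y
  norm_map : ∀ x : B₀.carrier, ‖toEquiv x‖ = ‖x‖
  cnorm_map : ∀ x y : B₀.carrier, B₁.cnorm ⟨toEquiv x, toEquiv y⟩ = B₀.cnorm ⟨x, y⟩

/-- The relation of being isomorphic. -/
def IsIso (B₀ B₁ : AbstractComplexLp.{u} p) : Prop := Nonempty (Iso B₀ B₁)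

end AbstractComplexLp

/-! ### The language of abstract complex `L^p` spaces -/

namespace LpLanguage

open ContLogic

/-- The function symbols `⊕_{s,t}` and `∧_{s,t}` for real `s`, `t` with `|s| + |t| ≤ 1`
(binary), and `| |` (unary). -/
inductive Fun : ℕ → Type where
  | lin (s t : ℝ) (h : |s| + |t| ≤ 1) : Fun 2
  | meet (s t : ℝ) (h : |s| + |t| ≤ 1) : Fun 2
  | abs : Fun 1

/-- The relation symbols `‖ ‖` (unary) and `‖ ‖_+` (binary). -/
inductive Rel : ℕ → Type where
  | norm : Rel 1
  | cnorm : Rel 2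

/-- The constant symbol `0`. -/
inductive Const : Type where
  | zero : Const

/-- The moduli are `ε ↦ 2 ε` for the binary function symbols and `ε ↦ ε` for `| |`. -/
def funModulus : {n : ℕ} → Fun n → ℝ → ℝ
  | _, .lin _ _ _, ε => 2 * ε
  | _, .meet _ _ _, ε => 2 * ε
  | _, .abs, ε => ε

/-- The moduli are `ε ↦ ε` for `‖ ‖` and `ε ↦ 2 ε` for `‖ ‖_+`. -/
def relModulus : {n : ℕ} → Rel n → ℝ → ℝ
  | _, .norm, ε => ε
  | _, .cnorm, ε => 2 * ε

/-- The language of Banach lattices together with the binary predicate symbol `‖ ‖_+`. -/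
def langLpC : MetricLanguage.{0} where
  Fun := Fun
  Rel := Rel
  Const := Const
  funModulus := funModulus
  relModulus := relModulus
  funModulus_pos f ε hε := by cases f <;> simp [funModulus, hε]
  relModulus_pos R ε hε := by cases R <;> simp [relModulus, hε]

end LpLanguage

/-! ### The interpretation on the unit ball -/

namespace AbstractComplexLp

open ContLogic LpLanguage

variable {p : ℝ}

/-- The closed unit ball of (the underlying real Banach lattice of) `B`. -/
@[ext]
structure UnitBall (B : AbstractComplexLp.{u} p) where
  val : B.carrier
  norm_le_one : ‖val‖ ≤ 1

namespace UnitBall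

variable {B : AbstractComplexLp.{u} p}

/-- The metric of the unit ball is `min(‖x - y‖, 1)`, so that the diameter is at most `1`. -/
noncomputable instance : MetricSpace (UnitBall B) where
  dist x y := min ‖x.val - y.val‖ 1
  dist_self x := by simp
  dist_comm x y := by rw [norm_sub_rev]
  dist_triangle x y z := by
    have h := norm_sub_le_norm_sub_add_norm_sub x.val y.val z.val
    have h1 := norm_nonneg (x.val - y.val)
    have h2 := norm_nonneg (y.val - z.val)
    rcases min_cases ‖x.val - y.val‖ 1 with h3 | h3 <;>
    rcases min_cases ‖y.val - z.val‖ 1 with h4 | h4 <;>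
    rcases min_cases ‖x.val - z.val‖ 1 with h5 | h5 <;> linarith
  eq_of_dist_eq_zero {x y} h := by
    have h' : min ‖x.val - y.val‖ 1 = 0 := h
    have : ‖x.val - y.val‖ = 0 := by
      rcases min_cases ‖x.val - y.val‖ 1 with h3 | h3 <;> linarith
    exact UnitBall.ext (sub_eq_zero.mp (norm_eq_zero.mp this))

theorem dist_def (x y : UnitBall B) : dist x y = min ‖x.val - y.val‖ 1 := rfl

theorem norm_sub_lt_of_dist_lt {x y : UnitBall B} {ε : ℝ} (h1 : ε ≤ 1) (h : dist x y < ε) :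
    ‖x.val - y.val‖ < ε := by
  rw [dist_def, min_lt_iff] at h
  rcases h with h | h
  · exact h
  · linarith

instance : CompleteSpace (UnitBall B) := by
  refine Metric.complete_of_cauchySeq_tendsto fun a ha => ?_
  have hc : CauchySeq (fun n => (a n).val) := by
    rw [Metric.cauchySeq_iff] at ha ⊢
    intro ε hε
    obtain ⟨N, hN⟩ := ha (min ε 1) (lt_min hε one_pos)
    refine ⟨N, fun m hm n hn => ?_⟩
    rw [dist_eq_norm]
    exact (norm_sub_lt_of_dist_lt (min_le_right _ _) (hN m hm n hn)).trans_le (min_le_left _ _)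
  obtain ⟨x, hx⟩ := cauchySeq_tendsto_of_complete hc
  have hx1 : ‖x‖ ≤ 1 :=
    le_of_tendsto hx.norm (Filter.Eventually.of_forall fun n => (a n).norm_le_one)
  refine ⟨⟨x, hx1⟩, ?_⟩
  rw [Metric.tendsto_atTop] at hx ⊢
  intro ε hε
  obtain ⟨N, hN⟩ := hx ε hε
  refine ⟨N, fun n hn => lt_of_le_of_lt (min_le_left _ _) ?_⟩
  have := hN n hn
  rwa [dist_eq_norm] at this

instance : Nonempty (UnitBall B) := ⟨⟨0, by simp⟩⟩

end UnitBall

variable (B : AbstractComplexLp.{u} p)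

theorem norm_smul_add_norm_smul_le {s t : ℝ} (h : |s| + |t| ≤ 1) {x y : B.carrier} {r : ℝ}
    (hr : 0 ≤ r) (hx : ‖x‖ ≤ r) (hy : ‖y‖ ≤ r) : ‖s • x‖ + ‖t • y‖ ≤ r := by
  rw [norm_smul, norm_smul, Real.norm_eq_abs, Real.norm_eq_abs]
  calc |s| * ‖x‖ + |t| * ‖y‖ ≤ |s| * r + |t| * r := by gcongr
    _ = (|s| + |t|) * r := by ring
    _ ≤ 1 * r := by gcongr
    _ = r := one_mul r

/-- `⊕_{s,t}(x, y) = s x + t y`, `∧_{s,t}(x, y) = s x ∧ t y`, and `| |` is the absolute value. -/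
def ballFn : {n : ℕ} → LpLanguage.Fun n → (Fin n → UnitBall B) → UnitBall B
  | _, .lin s t h, x => ⟨s • (x 0).val + t • (x 1).val,
      (norm_add_le _ _).trans (B.norm_smul_add_norm_smul_le h zero_le_one
        (x 0).norm_le_one (x 1).norm_le_one)⟩
  | _, .meet s t h, x => ⟨(s • (x 0).val) ⊓ (t • (x 1).val),
      (norm_inf_le_add _ _).trans (B.norm_smul_add_norm_smul_le h zero_le_one
        (x 0).norm_le_one (x 1).norm_le_one)⟩
  | _, .abs, x => ⟨|(x 0).val|, by rw [norm_abs_eq_norm]; exact (x 0).norm_le_one⟩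

/-- `‖ ‖` is the norm of `B`, and `‖(x, y)‖_+` is the norm of `x + i y`, truncated at `1`. -/
noncomputable def ballRel : {n : ℕ} → LpLanguage.Rel n → (Fin n → UnitBall B) → unitInterval
  | _, .norm, x => ⟨‖(x 0).val‖, norm_nonneg _, (x 0).norm_le_one⟩
  | _, .cnorm, x => ⟨min (B.cnorm ⟨(x 0).val, (x 1).val⟩) 1,
      le_min (apply_nonneg _ _) zero_le_one, min_le_right _ _⟩

theorem cnorm_le (x y : B.carrier) : B.cnorm ⟨x, y⟩ ≤ ‖x‖ + ‖y‖ := by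
  have h : (⟨x, y⟩ : Complexification B.carrier) = ⟨x, 0⟩ + Complex.I • ⟨y, 0⟩ := by
    ext <;> simp
  rw [h]
  refine (map_add_le_add _ _ _).trans ?_
  rw [map_smul_eq_mul, B.norm_eq_cnorm x, B.norm_eq_cnorm y]
  simp

theorem abs_cnorm_sub_le (x y x' y' : B.carrier) :
    |B.cnorm ⟨x, y⟩ - B.cnorm ⟨x', y'⟩| ≤ ‖x - x'‖ + ‖y - y'‖ := by
  have h : (⟨x, y⟩ : Complexification B.carrier) - ⟨x', y'⟩ = ⟨x - x', y - y'⟩ := by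
    rw [sub_eq_add_neg]
    ext <;> simp [sub_eq_add_neg]
  refine (abs_sub_map_le_sub B.cnorm _ _).trans ?_
  rw [h]
  exact B.cnorm_le _ _

theorem ballFn_modulus {n : ℕ} (f : LpLanguage.Fun n) :
    HasModulus (LpLanguage.funModulus f) (B.ballFn f) := by
  intro ε hε x y hxy
  rcases le_or_gt 1 ε with h1 | h1
  · refine (min_le_right _ _).trans ?_
    cases f <;> simp only [LpLanguage.funModulus] <;> linarith
  have hv : ∀ i, ‖(x i).val - (y i).val‖ ≤ ε := fun i => by
    have := hxy i
    rw [UnitBall.dist_def, min_le_iff] at this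
    exact this.resolve_right (not_le.mpr h1)
  refine (min_le_left _ _).trans ?_
  cases f with
  | lin s t h =>
    have h2 := B.norm_smul_add_norm_smul_le h hε.le (hv 0) (hv 1)
    have h3 : s • (x 0).val + t • (x 1).val - (s • (y 0).val + t • (y 1).val)
        = s • ((x 0).val - (y 0).val) + t • ((x 1).val - (y 1).val) := by module
    simp only [LpLanguage.funModulus, ballFn]
    rw [h3]
    have h4 := norm_add_le (s • ((x 0).val - (y 0).val)) (t • ((x 1).val - (y 1).val))
    linarith
  | meet s t h =>
    have h2 := B.norm_smul_add_norm_smul_le h hε.le (hv 0) (hv 1)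
    have h4 := norm_inf_sub_inf_le_add_norm (s • (x 0).val) (t • (x 1).val)
      (s • (y 0).val) (t • (y 1).val)
    rw [← smul_sub, ← smul_sub] at h4
    simp only [LpLanguage.funModulus, ballFn]
    linarith
  | abs =>
    simp only [LpLanguage.funModulus, ballFn]
    exact (norm_abs_sub_abs _ _).trans (hv 0)

theorem ballRel_modulus {n : ℕ} (R : LpLanguage.Rel n) :
    HasModulus (LpLanguage.relModulus R) (B.ballRel R) := by
  intro ε hε x y hxy
  rcases le_or_gt 1 ε with h1 | h1
  · have h2 : dist (B.ballRel R x) (B.ballRel R y) ≤ 1 := by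
      rw [Subtype.dist_eq, Real.dist_eq, abs_le]
      have a1 := (B.ballRel R x).2.1
      have a2 := (B.ballRel R x).2.2
      have a3 := (B.ballRel R y).2.1
      have a4 := (B.ballRel R y).2.2
      constructor <;> linarith
    refine h2.trans ?_
    cases R <;> simp only [LpLanguage.relModulus] <;> linarith
  have hv : ∀ i, ‖(x i).val - (y i).val‖ ≤ ε := fun i => by
    have := hxy i
    rw [UnitBall.dist_def, min_le_iff] at this
    exact this.resolve_right (not_le.mpr h1)
  rw [Subtype.dist_eq, Real.dist_eq]
  cases R with
  | norm => exact (abs_norm_sub_norm_le _ _).trans (hv 0)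
  | cnorm =>
    simp only [LpLanguage.relModulus, ballRel]
    refine (abs_min_sub_min_le_max _ _ _ _).trans ?_
    have h2 := B.abs_cnorm_sub_le (x 0).val (x 1).val (y 0).val (y 1).val
    have h3 := hv 0
    have h4 := hv 1
    simp only [sub_self, abs_zero]
    refine max_le ?_ ?_ <;> linarith

theorem uniformContinuous_of_modulus {M N : Type*} [PseudoMetricSpace M] [PseudoMetricSpace N]
    {n : ℕ} {Δ : ℝ → ℝ} (hΔ : ∀ ε : ℝ, 0 < ε → Δ ε ≤ 2 * ε) {f : (Fin n → M) → N}
    (hf : HasModulus Δ f) : UniformContinuous f := by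
  rw [Metric.uniformContinuous_iff]
  intro ε hε
  refine ⟨ε / 3, by positivity, fun x y hxy => ?_⟩
  have h1 := hf (ε / 3) (by positivity) x y (fun i => (dist_le_pi_dist x y i).trans hxy.le)
  have h2 := hΔ (ε / 3) (by positivity)
  linarith

/-- The interpretation `A_B` associated with an abstract complex `L^p` space `B`: the closed unit
ball of the underlying real Banach lattice, with the vector space and lattice operations, the norm
and the norm of the complexification. -/
noncomputable def unitBallInterpretation : Interpretation.{u} LpLanguage.langLpC where
  carrier := UnitBall B
  dist_le_one _ _ := min_le_right _ _
  fn f := B.ballFn f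
  rel R := B.ballRel R
  const _ := ⟨0, by simp⟩
  fn_uniformContinuous f := uniformContinuous_of_modulus
    (fun ε hε => by
      cases f <;> simp only [LpLanguage.funModulus] <;> linarith) (B.ballFn_modulus f)
  rel_uniformContinuous R := uniformContinuous_of_modulus
    (fun ε hε => by
      cases R <;> simp only [LpLanguage.relModulus] <;> linarith) (B.ballRel_modulus R)
  fn_modulus f := B.ballFn_modulus f
  rel_modulus R := B.ballRel_modulus R

end AbstractComplexLp

/-! The theory is the set of all sentences that hold in every `A_B`.  Any theory as asked for is
contained in it, so nothing is lost, and the unit balls are models by definition.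

*Isomorphisms.*  An isomorphism `φ` of unit balls extends to the whole spaces by `r z ↦ r φ(z)`.  Linear
combinations, infima and norms are brought into the unit ball by scaling, where `φ` preserves them
(`AbstractComplexLp.BallIso.toIso`).

*Embeddings.*  Let `M` be a model.  For finitely many formulas, instantiated at elements of `M`, some
`A_B` contains elements that give these formulas nearly the same values; otherwise a sentence
`sup (ε - ∑ |ψ_j - r_j|)` would belong to the theory and fail in `M`.  Along an ultrafilter on the finite
sets of such instances, this gives maps `g_i` of `M` to the unit balls of spaces `B i` that preserve all
formulas in the limit (`ContLogic.exists_tendsto_value`).  Hence `x ↦ [g_i(x)]` embeds `M` into the unit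
ball of the ultraproduct of the `B i`, that is, of the bounded families modulo the families that tend
to `0` along the ultrafilter.

*The ultraproduct is an abstract complex `L^p` space* (`AbstractComplexLp.Ultraproduct.space`).
Identities of lattice operations and norms pass to the limit, and disjoint elements have memberwise
disjoint representatives, because the common part of two representatives can be cut off.  The serious
point is that the limit of the norms of the complexifications is definite.  This needs a lower bound
`‖x‖ ≤ 4 ‖x + iy‖` that does not depend on the space (`AbstractComplexLp.norm_re_le_cnorm`), although
the axioms determine `‖u + iv‖` only for disjoint `u` and `v`, where it is `‖|u| + |v|‖`.  Heuristically,
with `M = |x| ⊔ |y|` and `m = |x| ⊓ |y|`, splitting `x + iy` along the set `{|x| ≥ |y|}` writes it as a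
sum of two disjoint pairs with moduli `M` and `m`, whence `‖x + iy‖ ≥ ‖M‖ - ‖m‖`.  The same inequality for
`(1 + i)(x + iy) = (x - y) + i(x + y)`, where `|x - y| ⊔ |x + y| = M + m` and
`|x - y| ⊓ |x + y| = M - m`, gives `2 ‖x + iy‖ ≥ ‖M + m‖ - ‖M - m‖ ≥ 2 ‖m‖ - ‖M‖`, and both together
`‖M‖ ≤ 4 ‖x + iy‖`.  Instead of a band projection, which need not be available, the truncations at the
levels `c⁺` and `c⁻` with `c = r (|x| - s |y|)` are used, `r` large and `s` close to `1`.  They leave a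
remainder supported near `|x| = s |y|`.  For many different `s` these zones are disjoint, and by the
additivity of `‖·‖ ^ p` one of them carries an arbitrarily small part of the norm. -/

/-! ### Signed truncations in lattice-ordered groups -/

namespace LatticeTruncation

variable {E : Type*} [AddCommGroup E] [Lattice E] [IsOrderedAddMonoid E]

theorem add_inf_le {a b c : E} (ha : 0 ≤ a) (hb : 0 ≤ b) (hc : 0 ≤ c) :
    (a + b) ⊓ c ≤ a ⊓ c + b ⊓ c := by
  rw [add_inf, inf_add, inf_add]
  refine le_inf (le_inf inf_le_left ?_) (le_inf ?_ ?_)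
  · exact inf_le_right.trans (le_add_of_nonneg_right hb)
  · exact inf_le_right.trans (le_add_of_nonneg_left ha)
  · exact inf_le_right.trans (le_add_of_nonneg_left hc)

theorem add_eq_sup_of_inf_eq_zero {a b : E} (h : a ⊓ b = 0) : a + b = a ⊔ b := by
  rw [← inf_add_sup a b, h, zero_add]

theorem inf_eq_zero_of_le {E : Type*} [AddCommGroup E] [Lattice E] {a b a' b' : E} (ha : 0 ≤ a)
    (hb : 0 ≤ b) (haa : a ≤ a') (hbb : b ≤ b') (h : a' ⊓ b' = 0) : a ⊓ b = 0 :=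
  le_antisymm ((inf_le_inf haa hbb).trans h.le) (le_inf ha hb)

theorem inf_add_of_inf_eq_zero {z c d : E} (hz : 0 ≤ z) (hc : 0 ≤ c) (hd : 0 ≤ d)
    (h : c ⊓ d = 0) : z ⊓ (c + d) = z ⊓ c + z ⊓ d := by
  apply le_antisymm
  · rw [inf_comm, inf_comm z c, inf_comm z d]
    exact add_inf_le hc hd hz
  · have h0 : (z ⊓ c) ⊓ (z ⊓ d) = 0 :=
      inf_eq_zero_of_le (le_inf hz hc) (le_inf hz hd) inf_le_right inf_le_right h
    rw [add_eq_sup_of_inf_eq_zero h0, add_eq_sup_of_inf_eq_zero h]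
    exact sup_le (inf_le_inf le_rfl le_sup_left) (inf_le_inf le_rfl le_sup_right)

theorem abs_sub_le_add {a b : E} (ha : 0 ≤ a) (hb : 0 ≤ b) : |a - b| ≤ a + b := by
  rw [sub_eq_add_neg]
  refine (abs_add_le _ _).trans ?_
  rw [abs_neg, abs_of_nonneg ha, abs_of_nonneg hb]

theorem abs_sub_of_inf_eq_zero {a b : E} (h : a ⊓ b = 0) : |a - b| = a + b := by
  rw [add_eq_sup_of_inf_eq_zero h, abs_sub_comm, ← sup_sub_inf_eq_abs_sub, h, sub_zero]

/-- The truncation of `x` at the level `d ≥ 0` that keeps the signs: pointwise, it is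
`sgn(x) · min(|x|, d)`. -/
def trunc (x d : E) : E := x⁺ ⊓ d - x⁻ ⊓ d

theorem abs_trunc (x : E) {d : E} (hd : 0 ≤ d) : |trunc x d| = |x| ⊓ d := by
  have h := posPart_inf_negPart_eq_zero x
  have h0 : (x⁺ ⊓ d) ⊓ (x⁻ ⊓ d) = 0 :=
    inf_eq_zero_of_le (le_inf (posPart_nonneg x) hd) (le_inf (negPart_nonneg x) hd)
      inf_le_left inf_le_left h
  rw [trunc, abs_sub_of_inf_eq_zero h0, ← posPart_add_negPart x, inf_comm, inf_comm (x⁻),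
    inf_comm _ d, inf_add_of_inf_eq_zero hd (posPart_nonneg x) (negPart_nonneg x) h]

theorem trunc_add (x : E) {c d : E} (hc : 0 ≤ c) (hd : 0 ≤ d) (h : c ⊓ d = 0) :
    trunc x (c + d) = trunc x c + trunc x d := by
  rw [trunc, inf_add_of_inf_eq_zero (posPart_nonneg x) hc hd h,
    inf_add_of_inf_eq_zero (negPart_nonneg x) hc hd h, trunc, trunc]
  abel

theorem abs_sub_trunc_le (x : E) {d : E} (hd : 0 ≤ d) : |x - trunc x d| ≤ |x| - |x| ⊓ d := by
  have h := posPart_inf_negPart_eq_zero x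
  have h1 : x - trunc x d = (x⁺ - x⁺ ⊓ d) - (x⁻ - x⁻ ⊓ d) := by
    nth_rewrite 1 [← posPart_sub_negPart x]
    rw [trunc]
    abel
  have h2 : |x| - |x| ⊓ d = (x⁺ - x⁺ ⊓ d) + (x⁻ - x⁻ ⊓ d) := by
    rw [← posPart_add_negPart x, inf_comm _ d,
      inf_add_of_inf_eq_zero hd (posPart_nonneg x) (negPart_nonneg x) h, inf_comm d, inf_comm d]
    abel
  rw [h1, h2]
  exact abs_sub_le_add (sub_nonneg.2 inf_le_left) (sub_nonneg.2 inf_le_left)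

theorem sub_inf_eq_posPart (a d : E) : a - a ⊓ d = (a - d)⁺ := by
  rw [sub_inf, sub_self, sup_comm, posPart_def]

/-- Cutting off the common part `|x| ⊓ |y|` makes two elements disjoint. -/
theorem abs_sub_trunc_inf_abs_sub_trunc (x y : E) :
    |x - trunc x (|x| ⊓ |y|)| ⊓ |y - trunc y (|x| ⊓ |y|)| = 0 := by
  have hz : 0 ≤ |x| ⊓ |y| := le_inf (abs_nonneg x) (abs_nonneg y)
  refine le_antisymm ?_ (le_inf (abs_nonneg _) (abs_nonneg _))
  refine (inf_le_inf (abs_sub_trunc_le x hz) (abs_sub_trunc_le y hz)).trans ?_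
  rw [inf_eq_right.2 inf_le_left, inf_eq_right.2 (inf_le_right : |x| ⊓ |y| ≤ |y|), ← inf_sub,
    sub_self]

theorem abs_add_le_abs_add_sup_abs_sub (x y : E) : |x| + |y| ≤ |x - y| ⊔ |x + y| := by
  have h1 : |x| + |y| = ((x + y) ⊔ (-x + y)) ⊔ ((x + -y) ⊔ (-x + -y)) := by
    rw [abs, abs, add_sup, sup_add, sup_add]
  rw [h1]
  refine sup_le (sup_le ?_ ?_) (sup_le ?_ ?_)
  · exact (le_abs_self _).trans le_sup_right
  · refine le_trans ?_ ((neg_le_abs (x - y)).trans le_sup_left)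
    rw [neg_sub, sub_eq_add_neg, add_comm]
  · rw [← sub_eq_add_neg]
    exact (le_abs_self _).trans le_sup_left
  · refine le_trans ?_ ((neg_le_abs (x + y)).trans le_sup_right)
    rw [neg_add]

variable [Module ℝ E] [PosSMulMono ℝ E]

theorem smul_inf {E : Type*} [AddCommGroup E] [Lattice E] [Module ℝ E] [PosSMulMono ℝ E] {r : ℝ}
    (hr : 0 < r) (a b : E) : r • (a ⊓ b) = (r • a) ⊓ (r • b) :=
  (OrderIso.smulRight hr).map_inf a b

theorem smul_sup {E : Type*} [AddCommGroup E] [Lattice E] [Module ℝ E] [PosSMulMono ℝ E] {r : ℝ}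
    (hr : 0 < r) (a b : E) : r • (a ⊔ b) = (r • a) ⊔ (r • b) :=
  (OrderIso.smulRight hr).map_sup a b

theorem inf_le_of_add_eq {p q m : E} (h : p + q = (2 : ℝ) • m) : p ⊓ q ≤ m := by
  have h1 : (2 : ℝ) • (p ⊓ q) ≤ (2 : ℝ) • m := by
    rw [← h, two_smul]
    exact add_le_add inf_le_left inf_le_right
  have h2 := smul_le_smul_of_nonneg_left h1 (by norm_num : (0 : ℝ) ≤ 2⁻¹)
  rwa [smul_smul, smul_smul, inv_mul_cancel₀ (by norm_num), one_smul, one_smul] at h2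

theorem abs_sub_inf_abs_add_le (x y : E) : |x - y| ⊓ |x + y| ≤ |x| ⊔ |y| := by
  let _ : DistribLattice E := AddCommGroup.toDistribLattice E
  have hx : x ≤ |x| ⊔ |y| := (le_abs_self x).trans le_sup_left
  have hx' : -x ≤ |x| ⊔ |y| := (neg_le_abs x).trans le_sup_left
  have hy : y ≤ |x| ⊔ |y| := (le_abs_self y).trans le_sup_right
  have hy' : -y ≤ |x| ⊔ |y| := (neg_le_abs y).trans le_sup_right
  have h1 : |x - y| ⊓ |x + y| = (((x - y) ⊓ (x + y)) ⊔ (-(x - y) ⊓ (x + y))) ⊔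
      (((x - y) ⊓ -(x + y)) ⊔ (-(x - y) ⊓ -(x + y))) := by
    rw [abs, abs, inf_sup_left, inf_sup_right, inf_sup_right]
  rw [h1]
  refine sup_le (sup_le ?_ ?_) (sup_le ?_ ?_)
  · exact (inf_le_of_add_eq (by module)).trans hx
  · exact (inf_le_of_add_eq (by module)).trans hy
  · exact (inf_le_of_add_eq (by module)).trans hy'
  · exact (inf_le_of_add_eq (by module)).trans hx'

theorem le_posPart_smul {r : ℝ} (hr : 1 ≤ r) (c : E) : c ≤ (r • c)⁺ := by
  have h0 : 0 ≤ (r • c)⁺ := posPart_nonneg _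
  have h1 : r⁻¹ • (r • c) ≤ r⁻¹ • (r • c)⁺ :=
    smul_le_smul_of_nonneg_left (le_posPart _) (by positivity)
  rw [smul_smul, inv_mul_cancel₀ (by positivity), one_smul] at h1
  have h2 : (0 : E) ≤ (1 - r⁻¹) • (r • c)⁺ :=
    smul_nonneg (sub_nonneg.2 (inv_le_one_of_one_le₀ hr)) h0
  rw [sub_smul, one_smul, sub_nonneg] at h2
  exact h1.trans h2

theorem le_smul_of_one_le {r : ℝ} (hr : 1 ≤ r) {a : E} (ha : 0 ≤ a) : a ≤ r • a := by
  have h2 : (0 : E) ≤ (r - 1) • a := smul_nonneg (sub_nonneg.2 hr) ha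
  rwa [sub_smul, one_smul, sub_nonneg] at h2

end LatticeTruncation

/-! ### A lower bound for the norm of the complexification -/

namespace AbstractComplexLp

open LatticeTruncation

variable {p : ℝ} (B : AbstractComplexLp.{u} p)

/-- A formally disjoint pair has the norm of `|u| + |v|`. -/
theorem cnorm_of_disjoint (hp : 0 < p) {u v : B.carrier} (h : |u| ⊓ |v| = 0) :
    B.cnorm ⟨u, v⟩ = ‖|u| + |v|‖ := by
  have h1 := B.cnorm_rpow u v h 1 Complex.I
  have h2 := B.norm_add_rpow |u| |v| (by rwa [abs_abs, abs_abs])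
  rw [norm_abs_eq_norm, norm_abs_eq_norm] at h2
  have h3 : (1 : ℂ) • (⟨u, 0⟩ : Complexification B.carrier) + Complex.I • ⟨v, 0⟩ = ⟨u, v⟩ := by
    ext <;> simp
  rw [h3, norm_one, Complex.norm_I, Real.one_rpow, one_mul, one_mul, ← h2] at h1
  exact (Real.rpow_left_inj (apply_nonneg _ _) (norm_nonneg _) hp.ne').1 h1

/-- Splitting `x + iy` into two formally disjoint pairs and a remainder, according to the positive
and the negative part of `c`. -/
theorem norm_sub_norm_le_cnorm_of_split (hp : 0 < p) (x y c : B.carrier) :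
    ‖|x| ⊓ c⁺ + |y| ⊓ c⁻‖ - ‖|x| ⊓ c⁻ + |y| ⊓ c⁺‖ -
      (‖|x| - |x| ⊓ |c|‖ + ‖|y| - |y| ⊓ |c|‖) ≤ B.cnorm ⟨x, y⟩ := by
  have hd := posPart_inf_negPart_eq_zero c
  have hd' : c⁻ ⊓ c⁺ = 0 := by rw [inf_comm, hd]
  have hp0 := posPart_nonneg c
  have hn0 := negPart_nonneg c
  have key : ∀ {d e : B.carrier}, 0 ≤ d → 0 ≤ e → d ⊓ e = 0 →
      B.cnorm ⟨trunc x d, trunc y e⟩ = ‖|x| ⊓ d + |y| ⊓ e‖ := by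
    intro d e h0 h1 h2
    have h3 : |trunc x d| ⊓ |trunc y e| = 0 := by
      rw [abs_trunc x h0, abs_trunc y h1]
      exact inf_eq_zero_of_le (le_inf (abs_nonneg _) h0) (le_inf (abs_nonneg _) h1)
        inf_le_right inf_le_right h2
    rw [B.cnorm_of_disjoint hp h3, abs_trunc x h0, abs_trunc y h1]
  have e1 : (⟨trunc x c⁺, trunc y c⁻⟩ : Complexification B.carrier) = ⟨x, y⟩ +
      -(⟨trunc x c⁻, trunc y c⁺⟩ + ⟨x - trunc x |c|, y - trunc y |c|⟩) := by
    have hx := trunc_add x hp0 hn0 hd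
    have hy := trunc_add y hp0 hn0 hd
    rw [posPart_add_negPart] at hx hy
    ext
    · simp only [Complexification.add_re, Complexification.neg_re, hx]; abel
    · simp only [Complexification.add_im, Complexification.neg_im, hy]; abel
  have e2 : B.cnorm ⟨x - trunc x |c|, y - trunc y |c|⟩ ≤
      ‖|x| - |x| ⊓ |c|‖ + ‖|y| - |y| ⊓ |c|‖ := by
    refine (B.cnorm_le _ _).trans (add_le_add ?_ ?_)
    · refine norm_le_norm_of_abs_le_abs ((abs_sub_trunc_le x (abs_nonneg c)).trans (le_abs_self _))
    · refine norm_le_norm_of_abs_le_abs ((abs_sub_trunc_le y (abs_nonneg c)).trans (le_abs_self _))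
  have e3 := map_add_le_add B.cnorm ⟨x, y⟩
    (-(⟨trunc x c⁻, trunc y c⁺⟩ + ⟨x - trunc x |c|, y - trunc y |c|⟩))
  rw [← e1, map_neg_eq_map, key hp0 hn0 hd] at e3
  have e4 := map_add_le_add B.cnorm ⟨trunc x c⁻, trunc y c⁺⟩ ⟨x - trunc x |c|, y - trunc y |c|⟩
  rw [key hn0 hp0 hd'] at e4
  linarith

theorem norm_le_norm_of_nonneg_of_le {a b : B.carrier} (ha : 0 ≤ a) (hab : a ≤ b) : ‖a‖ ≤ ‖b‖ :=
  norm_le_norm_of_abs_le_abs (by rwa [abs_of_nonneg ha, abs_of_nonneg (ha.trans hab)])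

/-- The splitting according to the sign of `|x| - s |y|`, amplified by `r`: up to an error supported
near `|x| = s |y|`, the two disjoint pairs have moduli `|x| ⊔ |y|` and `|x| ⊓ |y|`. -/
theorem norm_sup_sub_norm_inf_le_cnorm_add (hp : 0 < p) (x y : B.carrier) {s r : ℝ} (hs : 1 ≤ s)
    (hr : 1 ≤ r) :
    ‖|x| ⊔ |y|‖ - (2 * s - 1) * ‖|x| ⊓ |y|‖ -
      4 * ‖(|x| + |y| - |r • (|x| - s • |y|)|)⁺‖ ≤ B.cnorm ⟨x, y⟩ := by
  have h0 := B.norm_sub_norm_le_cnorm_of_split hp x y (r • (|x| - s • |y|))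
  set a := |x| with ha
  set b := |y| with hb
  have ha0 : 0 ≤ a := abs_nonneg x
  have hb0 : 0 ≤ b := abs_nonneg y
  set c := r • (a - s • b) with hc
  set t := (a + b - |c|)⁺ with ht
  have hp0 := posPart_nonneg c
  have hn0 := negPart_nonneg c
  have hd := posPart_inf_negPart_eq_zero c
  have hd' : c⁻ ⊓ c⁺ = 0 := by rw [inf_comm, hd]
  have hcp : a - s • b ≤ c⁺ := le_posPart_smul hr _
  have hcn : s • b - a ≤ c⁻ := by
    have h1 := le_posPart_smul hr (s • b - a)
    rwa [← neg_sub a, smul_neg, posPart_neg, neg_sub] at h1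
  have hbs : b ≤ s • b := le_smul_of_one_le hs hb0
  have h1 : a ⊓ c⁻ ≤ s • b := by
    have h2 : a ≤ s • b + c⁺ := by rwa [← sub_le_iff_le_add']
    calc a ⊓ c⁻ ≤ (s • b + c⁺) ⊓ c⁻ := inf_le_inf h2 le_rfl
      _ ≤ (s • b) ⊓ c⁻ + c⁺ ⊓ c⁻ := add_inf_le (hb0.trans hbs) hp0 hn0
      _ ≤ s • b := by rw [hd, add_zero]; exact inf_le_left
  have h2 : b ⊓ c⁺ ≤ a := by
    have h3 : b ≤ a + c⁻ := hbs.trans (by rwa [← sub_le_iff_le_add'])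
    calc b ⊓ c⁺ ≤ (a + c⁻) ⊓ c⁺ := inf_le_inf h3 le_rfl
      _ ≤ a ⊓ c⁺ + c⁻ ⊓ c⁺ := add_inf_le ha0 hn0 hp0
      _ ≤ a := by rw [hd', add_zero]; exact inf_le_left
  have hm0 : 0 ≤ a ⊓ b := le_inf ha0 hb0
  have hsm : s • (a ⊓ b) = (s • a) ⊓ (s • b) := smul_inf (by linarith) a b
  have h3 : a ⊓ c⁻ + b ⊓ c⁺ ≤ s • (a ⊓ b) := by
    have h4 : (a ⊓ c⁻) ⊓ (b ⊓ c⁺) = 0 := inf_eq_zero_of_le (le_inf ha0 hn0) (le_inf hb0 hp0)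
      inf_le_right inf_le_right hd'
    rw [add_eq_sup_of_inf_eq_zero h4, hsm]
    have h5 : a ≤ s • a := le_smul_of_one_le hs ha0
    exact sup_le (le_inf (inf_le_left.trans h5) h1)
      (le_inf (h2.trans h5) (inf_le_left.trans hbs))
  have h4 : ‖a ⊓ c⁻ + b ⊓ c⁺‖ ≤ s * ‖a ⊓ b‖ := by
    refine (B.norm_le_norm_of_nonneg_of_le (add_nonneg (le_inf ha0 hn0) (le_inf hb0 hp0)) h3).trans ?_
    rw [norm_smul, Real.norm_of_nonneg (by linarith)]
  have hla : ‖a - a ⊓ |c|‖ ≤ ‖t‖ := by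
    rw [sub_inf_eq_posPart]
    exact B.norm_le_norm_of_nonneg_of_le (posPart_nonneg _)
      (posPart_mono (sub_le_sub_right (le_add_of_nonneg_right hb0) _))
  have hlb : ‖b - b ⊓ |c|‖ ≤ ‖t‖ := by
    rw [sub_inf_eq_posPart]
    exact B.norm_le_norm_of_nonneg_of_le (posPart_nonneg _)
      (posPart_mono (sub_le_sub_right (le_add_of_nonneg_left ha0) _))
  -- The two pairs and the remainder add up to `a + b = a ⊔ b + a ⊓ b`.
  have h5 : a ⊔ b ≤ (a ⊓ c⁺ + b ⊓ c⁻) + (s - 1) • (a ⊓ b) + ((a - a ⊓ |c|) + (b - b ⊓ |c|)) := by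
    have h6 : a ⊓ |c| = a ⊓ c⁺ + a ⊓ c⁻ := by
      rw [← posPart_add_negPart c, inf_add_of_inf_eq_zero ha0 hp0 hn0 hd]
    have h7 : b ⊓ |c| = b ⊓ c⁺ + b ⊓ c⁻ := by
      rw [← posPart_add_negPart c, inf_add_of_inf_eq_zero hb0 hp0 hn0 hd]
    have h8 := inf_add_sup a b
    have h9 : a ⊔ b = a + b - a ⊓ b := by rw [← h8]; abel
    have h10 : a + b - a ⊓ b = (a ⊓ c⁺ + b ⊓ c⁻) + ((a ⊓ c⁻ + b ⊓ c⁺) - a ⊓ b) +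
        ((a - a ⊓ |c|) + (b - b ⊓ |c|)) := by
      rw [h6, h7]; abel
    rw [h9, h10, sub_smul, one_smul]
    exact add_le_add (add_le_add le_rfl (sub_le_sub_right h3 _)) le_rfl
  have h6 : ‖a ⊔ b‖ ≤ ‖a ⊓ c⁺ + b ⊓ c⁻‖ + (s - 1) * ‖a ⊓ b‖ + (‖t‖ + ‖t‖) := by
    refine (B.norm_le_norm_of_nonneg_of_le (ha0.trans le_sup_left) h5).trans ?_
    refine (norm_add_le _ _).trans (add_le_add ((norm_add_le _ _).trans (add_le_add le_rfl ?_))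
      ((norm_add_le _ _).trans (add_le_add hla hlb)))
    rw [norm_smul, Real.norm_of_nonneg (by linarith)]
  linarith

/-- The `p`-th powers of the norms of pairwise disjoint positive elements below `e` sum up to at most
`‖e‖ ^ p`. -/
theorem sum_norm_rpow_le (hp : 0 < p) {ι : Type*} (t : ι → B.carrier) {e : B.carrier}
    (ht0 : ∀ k, 0 ≤ t k) (hte : ∀ k, t k ≤ e) (he : 0 ≤ e)
    (s : Finset ι) (hd : ∀ j ∈ s, ∀ k ∈ s, j ≠ k → t j ⊓ t k = 0) :
    ∑ k ∈ s, ‖t k‖ ^ p ≤ ‖e‖ ^ p := by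
  classical
  have main : ∀ s : Finset ι, (∀ j ∈ s, ∀ k ∈ s, j ≠ k → t j ⊓ t k = 0) →
      ∑ k ∈ s, t k ≤ e ∧ (∀ z : B.carrier, 0 ≤ z → (∀ k ∈ s, t k ⊓ z = 0) →
        (∑ k ∈ s, t k) ⊓ z = 0) ∧ ∑ k ∈ s, ‖t k‖ ^ p = ‖∑ k ∈ s, t k‖ ^ p := by
    intro s
    induction s using Finset.induction_on with
    | empty =>
      intro _
      refine ⟨by simpa using he, fun z hz _ => by simpa using hz, ?_⟩
      simp [Real.zero_rpow hp.ne']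
    | insert i s hi ih =>
      intro hd
      obtain ⟨h1, h2, h3⟩ := ih fun j hj k hk => hd j (by simp [hj]) k (by simp [hk])
      have hs0 : 0 ≤ ∑ k ∈ s, t k := Finset.sum_nonneg fun k _ => ht0 k
      have h4 : t i ⊓ ∑ k ∈ s, t k = 0 := by
        rw [inf_comm]
        refine h2 _ (ht0 i) fun k hk => hd k (by simp [hk]) i (by simp) ?_
        rintro rfl
        exact hi hk
      rw [Finset.sum_insert hi, Finset.sum_insert hi]
      refine ⟨?_, fun z hz hk => ?_, ?_⟩
      · rw [add_eq_sup_of_inf_eq_zero h4]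
        exact sup_le (hte i) h1
      · refine le_antisymm ((add_inf_le (ht0 i) hs0 hz).trans ?_)
          (le_inf (add_nonneg (ht0 i) hs0) hz)
        rw [hk i (by simp), h2 z hz fun k hk' => hk k (by simp [hk']), add_zero]
      · rw [h3, B.norm_add_rpow _ _ (by rwa [abs_of_nonneg (ht0 i), abs_of_nonneg hs0])]
  obtain ⟨h1, -, h3⟩ := main s hd
  rw [h3]
  exact Real.rpow_le_rpow (norm_nonneg _) (B.norm_le_norm_of_nonneg_of_le
    (Finset.sum_nonneg fun k _ => ht0 k) h1) hp.le

/-- The zones near `a = s b` and near `a = s' b` are disjoint if the amplification is large. -/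
theorem posPart_inf_posPart_eq_zero {a b : B.carrier} (ha : 0 ≤ a) (hb : 0 ≤ b) {s s' r : ℝ}
    (hs : 0 ≤ s) (hs' : 0 ≤ s') (h6 : 2 + s + s' ≤ 6) (hr : 6 ≤ r * (s' - s)) :
    (a + b - |r • (a - s • b)|)⁺ ⊓ (a + b - |r • (a - s' • b)|)⁺ = 0 := by
  set c := r • (a - s • b) with hc
  set c' := r • (a - s' • b) with hc'
  set S := |c| ⊔ |c'| with hS
  have hS0 : 0 ≤ S := (abs_nonneg c).trans le_sup_left
  have h1 : (r * (s' - s)) • b ≤ (2 : ℝ) • S := by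
    have h2 : (r * (s' - s)) • b = c - c' := by rw [hc, hc']; module
    rw [h2, two_smul, sub_eq_add_neg]
    exact add_le_add ((le_abs_self c).trans le_sup_left) ((neg_le_abs c').trans le_sup_right)
  have h2 : (r * (s' - s)) • a ≤ (s + s') • S := by
    have h2 : (r * (s' - s)) • a = s' • c + s • (-c') := by rw [hc, hc']; module
    rw [h2, add_comm s s', add_smul]
    exact add_le_add
      (smul_le_smul_of_nonneg_left ((le_abs_self c).trans le_sup_left) hs')
      (smul_le_smul_of_nonneg_left ((neg_le_abs c').trans le_sup_right) hs)
  have h3 : (6 : ℝ) • (a + b) ≤ (6 : ℝ) • S := by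
    have h4 : (6 : ℝ) • (a + b) ≤ (r * (s' - s)) • (a + b) :=
      smul_le_smul_of_nonneg_right hr (add_nonneg ha hb)
    have h5 : (2 + s + s') • S ≤ (6 : ℝ) • S := smul_le_smul_of_nonneg_right h6 hS0
    refine h4.trans (le_trans ?_ h5)
    rw [smul_add, add_assoc, add_smul, add_comm]
    exact add_le_add h1 h2
  have h4 : a + b ≤ S := by
    have h5 := smul_le_smul_of_nonneg_left h3 (by norm_num : (0 : ℝ) ≤ 6⁻¹)
    rwa [smul_smul, smul_smul, inv_mul_cancel₀ (by norm_num), one_smul, one_smul] at h5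
  let _ : DistribLattice B.carrier := AddCommGroup.toDistribLattice _
  rw [posPart_def, posPart_def, ← sup_inf_right, ← sub_sup, sup_eq_right, sub_nonpos]
  exact h4

/-- For a suitable factor `s` near `1` and a large amplification `r`, the zone near `a = s b` carries
little mass: of many disjoint zones, at least one does. -/
theorem exists_norm_posPart_le (hp : 0 < p) {a b : B.carrier} (ha : 0 ≤ a) (hb : 0 ≤ b) {ε : ℝ}
    (hε : 0 < ε) : ∃ s r : ℝ, 1 ≤ s ∧ s ≤ 1 + ε ∧ 1 ≤ r ∧
      ‖(a + b - |r • (a - s • b)|)⁺‖ ≤ ε := by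
  -- The `K` factors `1 + k / K ^ 2` lie in `[1, 1 + 1 / K]` and have distances at least `1 / K ^ 2`.
  obtain ⟨K, hK⟩ := exists_nat_gt (max 1 (max (1 / ε) (‖a + b‖ ^ p / ε ^ p)))
  simp only [max_lt_iff] at hK
  obtain ⟨hK1, hK2, hK3⟩ := hK
  have hK0 : (0 : ℝ) < K := by linarith
  have hεp : 0 < ε ^ p := Real.rpow_pos_of_pos hε p
  set s : ℕ → ℝ := fun k => 1 + k / (K : ℝ) ^ 2 with hs
  set r : ℝ := 6 * (K : ℝ) ^ 2 with hr
  have hs1 : ∀ k, 1 ≤ s k := fun k => by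
    have : (0 : ℝ) ≤ k / (K : ℝ) ^ 2 := by positivity
    simp only [hs]; linarith
  have hsK : ∀ k < K, s k ≤ 1 + 1 / K := fun k hk => by
    have h1 : (k : ℝ) ≤ K := by exact_mod_cast hk.le
    have : k / (K : ℝ) ^ 2 ≤ 1 / K := by
      rw [div_le_div_iff₀ (by positivity) hK0]
      nlinarith
    simp only [hs]; linarith
  have hKi : 1 / (K : ℝ) ≤ 1 := by rw [div_le_one hK0]; exact hK1.le
  have hKe : 1 / (K : ℝ) ≤ ε := by
    rw [div_lt_iff₀ hε] at hK2
    rw [div_le_iff₀ hK0]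
    linarith
  have hr1 : 1 ≤ r := by simp only [hr]; nlinarith
  set t : ℕ → B.carrier := fun k => (a + b - |r • (a - s k • b)|)⁺ with ht
  have hlt : ∀ j ∈ Finset.range K, ∀ k ∈ Finset.range K, j < k → t j ⊓ t k = 0 := by
    intro j hj k hk hjk
    rw [Finset.mem_range] at hj hk
    refine B.posPart_inf_posPart_eq_zero ha hb (by linarith [hs1 j]) (by linarith [hs1 k])
      (by linarith [hsK j hj, hsK k hk]) ?_
    have h1 : (j : ℝ) + 1 ≤ k := by exact_mod_cast hjk
    have h2 : r * (s k - s j) = 6 * (k - j) := by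
      simp only [hr, hs]; field_simp; ring
    rw [h2]; linarith
  have hsum := B.sum_norm_rpow_le hp t (e := a + b) (fun k => posPart_nonneg _)
    (fun k => sup_le (sub_le_self _ (abs_nonneg _)) (add_nonneg ha hb)) (add_nonneg ha hb)
    (Finset.range K) (fun j hj k hk hjk => by
      rcases lt_or_gt_of_ne hjk with h | h
      · exact hlt j hj k hk h
      · rw [inf_comm]; exact hlt k hk j hj h)
  by_contra! hcon
  have hbig : ∀ k ∈ Finset.range K, ε ^ p ≤ ‖t k‖ ^ p := by
    intro k hk
    rw [Finset.mem_range] at hk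
    exact Real.rpow_le_rpow hε.le
      (hcon (s k) r (hs1 k) ((hsK k hk).trans (by linarith)) hr1).le hp.le
  have h1 := Finset.sum_le_sum hbig
  rw [Finset.sum_const, Finset.card_range, nsmul_eq_mul] at h1
  rw [div_lt_iff₀ hεp] at hK3
  linarith

/-- The error of the approximate splitting tends to `0` for suitable parameters.  If `x + iy` could be
split sharply along `{|x| ≥ |y|}`, this would be the triangle inequality for the two disjoint pairs
with moduli `|x| ⊔ |y|` and `|x| ⊓ |y|`. -/
theorem norm_sup_sub_norm_inf_le_cnorm (hp : 0 < p) (x y : B.carrier) :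
    ‖|x| ⊔ |y|‖ - ‖|x| ⊓ |y|‖ ≤ B.cnorm ⟨x, y⟩ := by
  refine le_of_forall_pos_le_add fun δ hδ => ?_
  have hn := norm_nonneg (|x| ⊓ |y|)
  set D := 2 * ‖|x| ⊓ |y|‖ + 4 with hD
  have hD0 : 0 < D := by linarith
  obtain ⟨s, r, hs, hs', hr, ht⟩ := B.exists_norm_posPart_le hp (abs_nonneg x) (abs_nonneg y)
    (div_pos hδ hD0)
  have h1 := B.norm_sup_sub_norm_inf_le_cnorm_add hp x y hs hr
  have h2 : δ / D * D = δ := div_mul_cancel₀ _ hD0.ne'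
  have h3 : (s - 1) * ‖|x| ⊓ |y|‖ ≤ δ / D * ‖|x| ⊓ |y|‖ :=
    mul_le_mul_of_nonneg_right (by linarith) hn
  rw [hD] at h2
  nlinarith

/-- The norm of the complexification is bounded below by a universal multiple of the norm of the
real part: the lower bounds for `x + iy` and `(1 + i)(x + iy)` cannot both be small. -/
theorem norm_re_le_cnorm (hp : 0 < p) (x y : B.carrier) : ‖x‖ ≤ 4 * B.cnorm ⟨x, y⟩ := by
  set N := B.cnorm ⟨x, y⟩ with hN
  have hN0 : 0 ≤ N := apply_nonneg _ _
  have h1 := B.norm_sup_sub_norm_inf_le_cnorm hp x y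
  -- Rotating by `1 + i` turns `|x| ⊔ |y|`, `|x| ⊓ |y|` into their sum and difference.
  have h2 := B.norm_sup_sub_norm_inf_le_cnorm hp (x - y) (x + y)
  have h3 : B.cnorm ⟨x - y, x + y⟩ ≤ 2 * N := by
    have h4 : (⟨x - y, x + y⟩ : Complexification B.carrier) =
        (⟨x, y⟩ : Complexification B.carrier) + Complex.I • ⟨x, y⟩ := by
      ext <;> simp [sub_eq_add_neg, add_comm]
    rw [h4]
    refine (map_add_le_add _ _ _).trans ?_
    rw [map_smul_eq_mul, Complex.norm_I]
    linarith
  have hm0 : 0 ≤ |x| ⊓ |y| := le_inf (abs_nonneg x) (abs_nonneg y)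
  have h4 : 2 * ‖|x| ⊓ |y|‖ ≤ ‖|x - y| ⊔ |x + y|‖ := by
    have h5 : (|x| ⊓ |y|) + (|x| ⊓ |y|) ≤ |x - y| ⊔ |x + y| :=
      (add_le_add inf_le_left inf_le_right).trans (abs_add_le_abs_add_sup_abs_sub x y)
    have h6 := B.norm_le_norm_of_nonneg_of_le (add_nonneg hm0 hm0) h5
    rwa [← two_smul ℝ, norm_smul, Real.norm_two] at h6
  have h5 : ‖|x - y| ⊓ |x + y|‖ ≤ ‖|x| ⊔ |y|‖ :=
    B.norm_le_norm_of_nonneg_of_le (le_inf (abs_nonneg _) (abs_nonneg _))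
      (abs_sub_inf_abs_add_le x y)
  have h6 : ‖x‖ ≤ ‖|x| ⊔ |y|‖ := by
    rw [← norm_abs_eq_norm x]
    exact B.norm_le_norm_of_nonneg_of_le (abs_nonneg x) le_sup_left
  linarith

theorem norm_im_le_cnorm (hp : 0 < p) (x y : B.carrier) : ‖y‖ ≤ 4 * B.cnorm ⟨x, y⟩ := by
  have h1 : (⟨y, -x⟩ : Complexification B.carrier) = (-Complex.I) • ⟨x, y⟩ := by
    ext <;> simp
  have h2 := B.norm_re_le_cnorm hp y (-x)
  rwa [h1, map_smul_eq_mul, norm_neg, Complex.norm_I, one_mul] at h2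

end AbstractComplexLp

/-! ### Approximate realization of finite pieces of the elementary diagram -/

namespace ContLogic

variable {L : MetricLanguage.{w}}

/-- Renaming of the variables of a term. -/
def Term.rename {m n : ℕ} (e : Fin m → Fin n) : Term L m → Term L n
  | .var i => .var (e i)
  | .const c => .const c
  | .app f ts => .app f (fun i => (ts i).rename e)

/-- Renaming of the free variables of a formula; the bound variable is always the last one. -/
def Formula.rename : {m n : ℕ} → (Fin m → Fin n) → Formula L m → Formula L n
  | _, _, e, .dist t₁ t₂ => .dist (t₁.rename e) (t₂.rename e)
  | _, _, e, .rel R ts => .rel R (fun i => (ts i).rename e)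
  | _, _, e, .conn c φs => .conn c (fun i => (φs i).rename e)
  | _, n, e, .sup φ => .sup (φ.rename (Fin.snoc (fun i => (e i).castSucc) (Fin.last n)))
  | _, n, e, .inf φ => .inf (φ.rename (Fin.snoc (fun i => (e i).castSucc) (Fin.last n)))

/-- The universal closure of a formula: all free variables are bound by `sup`. -/
def Formula.supClosure : {n : ℕ} → Formula L n → Sentence L
  | 0, φ => φ
  | _ + 1, φ => Formula.supClosure (.sup φ)

namespace Interpretation

theorem termValue_rename (M : Interpretation.{u} L) {m n : ℕ} (e : Fin m → Fin n)
    (v : Fin n → M.carrier) (t : Term L m) :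
    M.termValue v (t.rename e) = M.termValue (v ∘ e) t := by
  induction t with
  | var i => rfl
  | const c => rfl
  | app f ts ih => simp only [Term.rename, termValue, ih]

theorem snoc_comp_snoc {α : Type*} {m n : ℕ} (e : Fin m → Fin n) (v : Fin n → α) (x : α) :
    (Fin.snoc v x : Fin (n + 1) → α) ∘
      (Fin.snoc (fun i => (e i).castSucc) (Fin.last n) : Fin (m + 1) → Fin (n + 1)) =
      (Fin.snoc (v ∘ e) x : Fin (m + 1) → α) := by
  funext i
  refine Fin.lastCases ?_ (fun i => ?_) i <;> simp

theorem value_rename (M : Interpretation.{u} L) {m : ℕ} (φ : Formula L m) :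
    ∀ {n : ℕ} (e : Fin m → Fin n) (v : Fin n → M.carrier),
      M.value (φ.rename e) v = M.value φ (v ∘ e) := by
  induction φ with
  | dist t₁ t₂ => intro n e v; simp only [Formula.rename, value, termValue_rename]
  | rel R ts => intro n e v; simp only [Formula.rename, value, termValue_rename]
  | conn c φs ih => intro n e v; simp only [Formula.rename, value, ih]
  | sup φ ih => intro n e v; simp only [Formula.rename, value, ih, snoc_comp_snoc]
  | inf φ ih => intro n e v; simp only [Formula.rename, value, ih, snoc_comp_snoc]

theorem satisfies_supClosure (M : Interpretation.{u} L) {n : ℕ} (φ : Formula L n) :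
    M.Satisfies φ.supClosure ↔ ∀ v : Fin n → M.carrier, M.value φ v = 0 := by
  induction n with
  | zero =>
    refine ⟨fun h v => ?_, fun h => h _⟩
    rw [Subsingleton.elim v Fin.elim0]
    exact h
  | succ n ih =>
    have h0 : ∀ v : Fin n → M.carrier, M.value (.sup φ) v = 0 ↔
        ∀ x, M.value φ (Fin.snoc v x) = 0 := fun v => iSup_eq_bot
    rw [Formula.supClosure, ih]
    simp only [h0]
    refine ⟨fun h v => ?_, fun h v x => h _⟩
    rw [← Fin.snoc_init_self v]
    exact h _ _

end Interpretation

/-- The connective `(t_j)_j ↦ max(0, ε - ∑ |t_j - r_j|)` (cut off at `1`). -/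
noncomputable def closenessConn {k : ℕ} (ε : ℝ) (r : Fin k → unitInterval) :
    C(Fin k → unitInterval, unitInterval) where
  toFun t := Set.projIcc 0 1 zero_le_one (ε - ∑ j, |(t j : ℝ) - r j|)
  continuous_toFun := continuous_projIcc.comp (by fun_prop)

theorem closenessConn_eq_zero {k : ℕ} {ε : ℝ} {r t : Fin k → unitInterval} :
    closenessConn ε r t = 0 ↔ ε ≤ ∑ j, |(t j : ℝ) - r j| :=
  (Set.projIcc_eq_left zero_lt_one).trans sub_nonpos

/-- The theory of a class of interpretations: the sentences that hold in all of its members. -/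
def theoryOf {K : Type*} (A : K → Interpretation.{u} L) : Theory L :=
  {φ | ∀ B : K, (A B).Satisfies φ}

section Realization

variable {K : Type*} {A : K → Interpretation.{u} L} {M : Interpretation.{u} L}

/-- An instance of a formula at elements of `M`. -/
abbrev DiagramItem (M : Interpretation.{u} L) : Type (max u w) :=
  Σ k : ℕ, Formula L k × (Fin k → M.carrier)

/-- If no member of the class came close, then the sentence `sup (ε - ∑ |ψ_j - r_j|)` would belong
to its theory, but it fails in `M`. -/
theorem exists_value_close (hM : M.IsModel (theoryOf A)) {n k : ℕ} (m : Fin n → M.carrier)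
    (ψ : Fin k → Formula L n) {ε : ℝ} (hε : 0 < ε) :
    ∃ (B : K) (b : Fin n → (A B).carrier),
      ∀ j, |((A B).value (ψ j) b : ℝ) - M.value (ψ j) m| < ε := by
  by_contra! hcon
  have h1 : (Formula.conn (closenessConn ε fun j => M.value (ψ j) m) ψ).supClosure ∈
      theoryOf A := by
    intro B
    rw [Interpretation.satisfies_supClosure]
    intro b
    simp only [Interpretation.value]
    rw [closenessConn_eq_zero]
    obtain ⟨j, hj⟩ := hcon B b
    exact hj.trans (Finset.single_le_sum
      (f := fun j => |((A B).value (ψ j) b : ℝ) - M.value (ψ j) m|)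
      (fun i _ => abs_nonneg _) (Finset.mem_univ j))
  have h2 := (M.satisfies_supClosure _).1 (hM _ h1) m
  simp only [Interpretation.value] at h2
  rw [closenessConn_eq_zero] at h2
  simp only [sub_self, abs_zero, Finset.sum_const_zero] at h2
  linarith

theorem exists_map_value_close (hM : M.IsModel (theoryOf A)) (S : Finset (DiagramItem M))
    {ε : ℝ} (hε : 0 < ε) :
    ∃ (B : K) (g : M.carrier → (A B).carrier),
      ∀ d ∈ S, |((A B).value d.2.1 (g ∘ d.2.2) : ℝ) - M.value d.2.1 d.2.2| < ε := by
  classical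
  obtain ⟨x₀⟩ := M.nonempty
  -- All elements of `M` that occur in `S` are enumerated by a tuple `m` with partial inverse `e`.
  set F : Finset M.carrier := insert x₀ (S.biUnion fun d => Finset.univ.image d.2.2) with hF
  have hx₀ : x₀ ∈ F := Finset.mem_insert_self _ _
  set m : Fin F.card → M.carrier := fun i => (F.equivFin.symm i : M.carrier) with hm
  set e : M.carrier → Fin F.card := fun x =>
    if h : x ∈ F then F.equivFin ⟨x, h⟩ else F.equivFin ⟨x₀, hx₀⟩ with he
  have hme : ∀ x ∈ F, m (e x) = x := fun x hx => by simp [hm, he, hx]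
  obtain ⟨B, b, hb⟩ := exists_value_close hM m
    (fun j : Fin S.card => (S.equivFin.symm j).1.2.1.rename (e ∘ (S.equivFin.symm j).1.2.2)) hε
  refine ⟨B, b ∘ e, fun d hd => ?_⟩
  have h1 := hb (S.equivFin ⟨d, hd⟩)
  rw [Interpretation.value_rename, Interpretation.value_rename, Equiv.symm_apply_apply] at h1
  have h2 : m ∘ (e ∘ d.2.2) = d.2.2 := by
    funext i
    refine hme _ ?_
    rw [hF]
    exact Finset.mem_insert_of_mem (Finset.mem_biUnion.2
      ⟨d, hd, Finset.mem_image_of_mem _ (Finset.mem_univ i)⟩)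
  rw [h2] at h1
  exact h1

/-- A model of the theory of a class maps to a family of members of the class, indexed by a set with
an ultrafilter, in such a way that all formulas are preserved in the limit. -/
theorem exists_tendsto_value (hM : M.IsModel (theoryOf A)) :
    ∃ (I : Type (max u w)) (U : Ultrafilter I) (B : I → K)
      (g : ∀ i, M.carrier → (A (B i)).carrier),
      ∀ (k : ℕ) (ψ : Formula L k) (a : Fin k → M.carrier),
        Filter.Tendsto (fun i => ((A (B i)).value ψ (g i ∘ a) : ℝ)) U
          (nhds (M.value ψ a : ℝ)) := by
  classical
  choose B g hg using fun i : Finset (DiagramItem M) × ℕ =>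
    exists_map_value_close hM i.1 (ε := 1 / ((i.2 : ℝ) + 1)) (by positivity)
  refine ⟨_, Ultrafilter.of Filter.atTop, B, g, fun k ψ a => ?_⟩
  refine Filter.Tendsto.mono_left ?_ (Ultrafilter.of_le _)
  rw [Metric.tendsto_atTop]
  intro ε hε
  obtain ⟨N, hN⟩ := exists_nat_one_div_lt hε
  refine ⟨({⟨k, ψ, a⟩}, N), fun i hi => ?_⟩
  have h1 := hg i ⟨k, ψ, a⟩ (hi.1 (Finset.mem_singleton_self _))
  rw [Real.dist_eq]
  refine h1.trans (lt_of_le_of_lt ?_ hN)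
  have h2 : (N : ℝ) ≤ i.2 := by exact_mod_cast hi.2
  exact one_div_le_one_div_of_le (by positivity) (by linarith)

end Realization

end ContLogic

/-! ### Ultraproducts of abstract complex `L^p` spaces -/

namespace AbstractComplexLp

open Filter Topology LatticeTruncation
open scoped ENNReal

section UltrafilterLimit

variable {I : Type*} (U : Ultrafilter I)

theorem tendsto_limUnder_of_bounded {f : I → ℝ} {C : ℝ} (hf : ∀ i, |f i| ≤ C) :
    Tendsto f U (𝓝 (limUnder (U : Filter I) f)) := by
  have h1 : (U.map f : Filter ℝ) ≤ 𝓟 (Set.Icc (-C) C) := by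
    rw [le_principal_iff]
    exact Filter.mem_map.2 (Filter.univ_mem' fun i => abs_le.1 (hf i))
  obtain ⟨a, -, ha⟩ := isCompact_Icc.ultrafilter_le_nhds _ h1
  exact tendsto_nhds_limUnder ⟨a, ha⟩

end UltrafilterLimit

variable {p : ℝ} {I : Type u} (U : Ultrafilter I) (B : I → AbstractComplexLp.{u} p)

/-- The bounded families `(x_i)` with `x_i ∈ B i`, with the supremum norm. -/
abbrev BoundedFamily : Type u := lp (fun i => (B i).carrier) ∞

namespace BoundedFamily

variable {B}

/-- The bounded family with prescribed members. -/
def ofBound (x : ∀ i, (B i).carrier) (C : ℝ) (h : ∀ i, ‖x i‖ ≤ C) : BoundedFamily B :=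
  ⟨x, memℓp_infty ⟨C, by rintro _ ⟨i, rfl⟩; exact h i⟩⟩

theorem norm_apply_le (x : BoundedFamily B) (i : I) : ‖x i‖ ≤ ‖x‖ :=
  lp.norm_apply_le_norm ENNReal.top_ne_zero x i

/-- The memberwise supremum. -/
noncomputable def sup (x y : BoundedFamily B) : BoundedFamily B :=
  ofBound (fun i => x i ⊔ y i) (‖x‖ + ‖y‖) fun i =>
    (norm_sup_le_add _ _).trans (add_le_add (norm_apply_le x i) (norm_apply_le y i))

/-- The memberwise infimum. -/
noncomputable def inf (x y : BoundedFamily B) : BoundedFamily B :=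
  ofBound (fun i => x i ⊓ y i) (‖x‖ + ‖y‖) fun i =>
    (norm_inf_le_add _ _).trans (add_le_add (norm_apply_le x i) (norm_apply_le y i))

/-- The memberwise absolute value. -/
noncomputable def abs (x : BoundedFamily B) : BoundedFamily B :=
  ofBound (fun i => |x i|) ‖x‖ fun i => by rw [norm_abs_eq_norm]; exact norm_apply_le x i

end BoundedFamily

open BoundedFamily

/-- The bounded families that tend to `0` along the ultrafilter. -/
def nullFamilies : Submodule ℝ (BoundedFamily B) where
  carrier := {x | Tendsto (fun i => ‖x i‖) U (𝓝 0)}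
  zero_mem' := by simp
  add_mem' {x y} hx hy := by
    have h : Tendsto (fun i => ‖x i‖ + ‖y i‖) U (𝓝 0) := by simpa using Tendsto.add hx hy
    exact squeeze_zero (fun i => norm_nonneg _) (fun i => norm_add_le (x i) (y i)) h
  smul_mem' c x hx := by
    have h : Tendsto (fun i => ‖c‖ * ‖x i‖) U (𝓝 0) := by
      simpa using Tendsto.const_mul ‖c‖ hx
    exact h.congr fun i => (norm_smul c (x i)).symm

theorem mem_nullFamilies {x : BoundedFamily B} :
    x ∈ nullFamilies U B ↔ Tendsto (fun i => ‖x i‖) U (𝓝 0) := Iff.rfl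

instance isClosed_nullFamilies : IsClosed (nullFamilies U B : Set (BoundedFamily B)) := by
  refine isClosed_of_closure_subset fun x hx => ?_
  rw [SetLike.mem_coe, mem_nullFamilies, Metric.tendsto_nhds]
  intro ε hε
  obtain ⟨y, hy, hxy⟩ := Metric.mem_closure_iff.1 hx (ε / 2) (half_pos hε)
  filter_upwards [(Metric.tendsto_nhds.1 hy) (ε / 2) (half_pos hε)] with i hi
  rw [Real.dist_eq, sub_zero, abs_norm] at hi ⊢
  have h1 := norm_apply_le (x - y) i
  rw [← dist_eq_norm] at h1
  have h2 : ‖x i‖ ≤ ‖(x - y) i‖ + ‖y i‖ := norm_le_norm_sub_add (x i) (y i)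
  linarith

/-- The underlying Banach space of the ultraproduct of the spaces `B i`. -/
abbrev Ultraproduct : Type u := BoundedFamily B ⧸ nullFamilies U B

namespace Ultraproduct

variable {B}

/-- The class of a bounded family in the ultraproduct. -/
noncomputable abbrev mk (x : BoundedFamily B) : Ultraproduct U B := Submodule.Quotient.mk x

variable (B) in
theorem mk_surjective : Function.Surjective (mk U : BoundedFamily B → Ultraproduct U B) :=
  Submodule.Quotient.mk_surjective _

variable {U}

/-- A family that represents an element of the ultraproduct. -/
noncomputable def rep (a : Ultraproduct U B) : BoundedFamily B :=
  Function.surjInv (mk_surjective U B) a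

@[simp] theorem mk_rep (a : Ultraproduct U B) : mk U (rep a) = a :=
  Function.surjInv_eq (mk_surjective U B) a

theorem mk_eq_mk {x y : BoundedFamily B} :
    mk U x = mk U y ↔ Tendsto (fun i => ‖x i - y i‖) U (𝓝 0) :=
  Submodule.Quotient.eq _

theorem tendsto_rep_mk (x : BoundedFamily B) :
    Tendsto (fun i => ‖rep (mk U x) i - x i‖) U (𝓝 0) :=
  mk_eq_mk.1 (mk_rep _)

theorem mk_congr {x y : BoundedFamily B} (h : ∀ i, x i = y i) : mk U x = mk U y :=
  congrArg _ (lp.ext (funext h))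

/-- The norm of the ultraproduct is the limit of the norms along the ultrafilter. -/
theorem tendsto_norm (x : BoundedFamily B) : Tendsto (fun i => ‖x i‖) U (𝓝 ‖mk U x‖) := by
  have hl := tendsto_limUnder_of_bounded U (f := fun i => ‖x i‖) (C := ‖x‖)
    fun i => by rw [abs_norm]; exact norm_apply_le x i
  set l := limUnder (U : Filter I) fun i => ‖x i‖ with hl'
  have hl0 : 0 ≤ l := ge_of_tendsto hl (Eventually.of_forall fun i => norm_nonneg _)
  suffices h : ‖mk U x‖ = l by rwa [h]
  apply le_antisymm
  · refine le_of_forall_pos_le_add fun ε hε => ?_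
    classical
    -- Members of norm above `l + ε` occur on a null set only, and may be replaced by `0`.
    set y : BoundedFamily B := ofBound (fun i => if ‖x i‖ ≤ l + ε then x i else 0) (l + ε)
      (fun i => by
        split_ifs with h
        · exact h
        · rw [norm_zero]; linarith) with hy
    have h1 : mk U x = mk U y := by
      rw [mk_eq_mk]
      refine tendsto_const_nhds.congr' ?_
      filter_upwards [hl.eventually_le_const (show l < l + ε by linarith)] with i hi
      have h2 : y i = x i := if_pos hi
      rw [h2, sub_self, norm_zero]
    rw [h1]
    refine (Submodule.Quotient.norm_mk_le _ y).trans (lp.norm_le_of_forall_le (by linarith) ?_)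
    intro i
    change ‖if ‖x i‖ ≤ l + ε then x i else 0‖ ≤ l + ε
    split_ifs with h
    · exact h
    · rw [norm_zero]; linarith
  · refine (QuotientAddGroup.le_norm_iff (S := (nullFamilies U B).toAddSubgroup)).2 fun m hm => ?_
    have h1 : Tendsto (fun i => ‖x i - m i‖) U (𝓝 0) :=
      mk_eq_mk.1 (show mk U x = mk U m from hm.symm)
    have h2 : Tendsto (fun i => ‖x i - m i‖ + ‖m‖) U (𝓝 (0 + ‖m‖)) := h1.add_const _
    rw [zero_add] at h2
    refine le_of_tendsto_of_tendsto' hl h2 fun i => ?_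
    have h3 := norm_apply_le m i
    have h4 : ‖x i‖ ≤ ‖x i - m i‖ + ‖m i‖ := norm_le_norm_sub_add (x i) (m i)
    linarith

/-! ### The lattice structure of an ultraproduct -/

noncomputable instance : Max (Ultraproduct U B) := ⟨fun a b => mk U ((rep a).sup (rep b))⟩

noncomputable instance : Min (Ultraproduct U B) := ⟨fun a b => mk U ((rep a).inf (rep b))⟩

theorem mk_sup (x y : BoundedFamily B) : mk U x ⊔ mk U y = mk U (x.sup y) := by
  refine mk_eq_mk.2 (squeeze_zero (fun i => norm_nonneg _)
    (fun i => norm_sup_sub_sup_le_add_norm _ _ _ _) ?_)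
  simpa using (tendsto_rep_mk x).add (tendsto_rep_mk y)

theorem mk_inf (x y : BoundedFamily B) : mk U x ⊓ mk U y = mk U (x.inf y) := by
  refine mk_eq_mk.2 (squeeze_zero (fun i => norm_nonneg _)
    (fun i => norm_inf_sub_inf_le_add_norm _ _ _ _) ?_)
  simpa using (tendsto_rep_mk x).add (tendsto_rep_mk y)

noncomputable instance : Lattice (Ultraproduct U B) :=
  Lattice.mk'
    (fun a b => by
      obtain ⟨x, rfl⟩ := mk_surjective U B a
      obtain ⟨y, rfl⟩ := mk_surjective U B b
      rw [mk_sup, mk_sup]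
      exact mk_congr fun i => sup_comm _ _)
    (fun a b c => by
      obtain ⟨x, rfl⟩ := mk_surjective U B a
      obtain ⟨y, rfl⟩ := mk_surjective U B b
      obtain ⟨z, rfl⟩ := mk_surjective U B c
      rw [mk_sup, mk_sup, mk_sup, mk_sup]
      exact mk_congr fun i => sup_assoc _ _ _)
    (fun a b => by
      obtain ⟨x, rfl⟩ := mk_surjective U B a
      obtain ⟨y, rfl⟩ := mk_surjective U B b
      rw [mk_inf, mk_inf]
      exact mk_congr fun i => inf_comm _ _)
    (fun a b c => by
      obtain ⟨x, rfl⟩ := mk_surjective U B a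
      obtain ⟨y, rfl⟩ := mk_surjective U B b
      obtain ⟨z, rfl⟩ := mk_surjective U B c
      rw [mk_inf, mk_inf, mk_inf, mk_inf]
      exact mk_congr fun i => inf_assoc _ _ _)
    (fun a b => by
      obtain ⟨x, rfl⟩ := mk_surjective U B a
      obtain ⟨y, rfl⟩ := mk_surjective U B b
      rw [mk_inf, mk_sup]
      exact mk_congr fun i => sup_inf_self)
    (fun a b => by
      obtain ⟨x, rfl⟩ := mk_surjective U B a
      obtain ⟨y, rfl⟩ := mk_surjective U B b
      rw [mk_sup, mk_inf]
      exact mk_congr fun i => inf_sup_self)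

theorem mk_le_mk {x y : BoundedFamily B} : mk U x ≤ mk U y ↔ mk U (x.sup y) = mk U y := by
  rw [← mk_sup]
  exact sup_eq_right.symm

instance : IsOrderedAddMonoid (Ultraproduct U B) where
  add_le_add_left a b h c := by
    obtain ⟨x, rfl⟩ := mk_surjective U B a
    obtain ⟨y, rfl⟩ := mk_surjective U B b
    obtain ⟨z, rfl⟩ := mk_surjective U B c
    rw [mk_le_mk] at h
    have h1 : mk U ((x + z).sup (y + z)) = mk U (x.sup y) + mk U z :=
      mk_congr fun i => (sup_add (x i) (y i) (z i)).symm
    exact mk_le_mk.2 (h1.trans (by rw [h]; rfl))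

instance : PosSMulMono ℝ (Ultraproduct U B) where
  smul_le_smul_of_nonneg_left c hc a b h := by
    obtain ⟨x, rfl⟩ := mk_surjective U B a
    obtain ⟨y, rfl⟩ := mk_surjective U B b
    rw [mk_le_mk] at h
    have h1 : mk U ((c • x).sup (c • y)) = c • mk U (x.sup y) := by
      refine mk_congr fun i => ?_
      change (c • x i) ⊔ (c • y i) = c • (x i ⊔ y i)
      rcases hc.eq_or_lt with rfl | hc
      · simp
      · exact (smul_sup hc (x i) (y i)).symm
    exact mk_le_mk.2 (h1.trans (by rw [h]; rfl))

theorem abs_mk (x : BoundedFamily B) : |mk U x| = mk U x.abs :=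
  mk_sup x (-x)

instance : HasSolidNorm (Ultraproduct U B) where
  solid a b h := by
    obtain ⟨x, rfl⟩ := mk_surjective U B a
    obtain ⟨y, rfl⟩ := mk_surjective U B b
    have h1 : mk U x.abs = mk U (x.abs.inf y.abs) := by
      rw [← mk_inf, ← abs_mk, ← abs_mk]
      exact (inf_eq_left.2 h).symm
    have h2 := tendsto_norm (U := U) (x.abs.inf y.abs)
    rw [← h1] at h2
    have h3 : ‖mk U x‖ = ‖mk U x.abs‖ := by
      refine tendsto_nhds_unique (tendsto_norm x) ((tendsto_norm x.abs).congr fun i => ?_)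
      exact norm_abs_eq_norm (x i)
    rw [h3]
    refine le_of_tendsto_of_tendsto' h2 (tendsto_norm y) fun i => ?_
    have h4 : 0 ≤ |x i| ⊓ |y i| := le_inf (abs_nonneg _) (abs_nonneg _)
    change ‖|x i| ⊓ |y i|‖ ≤ ‖y i‖
    rw [← norm_abs_eq_norm (y i)]
    exact (B i).norm_le_norm_of_nonneg_of_le h4 inf_le_right

/-- Disjoint elements of the ultraproduct have memberwise disjoint representatives: the common part
of two representatives tends to `0`, and may be cut off. -/
theorem exists_disjoint_rep {a b : Ultraproduct U B} (h : |a| ⊓ |b| = 0) :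
    ∃ x y : BoundedFamily B, mk U x = a ∧ mk U y = b ∧ ∀ i, |x i| ⊓ |y i| = 0 := by
  obtain ⟨x, rfl⟩ := mk_surjective U B a
  obtain ⟨y, rfl⟩ := mk_surjective U B b
  have hz0 : ∀ i, 0 ≤ |x i| ⊓ |y i| := fun i => le_inf (abs_nonneg _) (abs_nonneg _)
  have hz : Tendsto (fun i => ‖|x i| ⊓ |y i|‖) U (𝓝 0) := by
    rw [abs_mk, abs_mk, mk_inf] at h
    exact (Submodule.Quotient.mk_eq_zero _).1 h
  have key : ∀ w : BoundedFamily B, (∀ i, |x i| ⊓ |y i| ≤ |w i|) →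
      ∃ w' : BoundedFamily B, mk U w' = mk U w ∧ ∀ i, w' i = w i - trunc (w i) (|x i| ⊓ |y i|) := by
    intro w hw
    have hn : ∀ i, ‖trunc (w i) (|x i| ⊓ |y i|)‖ = ‖|x i| ⊓ |y i|‖ := fun i => by
      rw [← norm_abs_eq_norm, abs_trunc _ (hz0 i), inf_eq_right.2 (hw i)]
    refine ⟨ofBound (fun i => w i - trunc (w i) (|x i| ⊓ |y i|)) (2 * ‖w‖) fun i => ?_, ?_,
      fun i => rfl⟩
    · refine (norm_sub_le _ _).trans ?_
      rw [hn]
      have h1 := norm_apply_le w i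
      have h2 := (B i).norm_le_norm_of_nonneg_of_le (hz0 i) (hw i)
      rw [norm_abs_eq_norm] at h2
      linarith
    · refine mk_eq_mk.2 (hz.congr fun i => ?_)
      change _ = ‖w i - trunc (w i) (|x i| ⊓ |y i|) - w i‖
      rw [sub_sub_cancel_left, norm_neg, hn]
  obtain ⟨x', hx', hx⟩ := key x fun i => inf_le_left
  obtain ⟨y', hy', hy⟩ := key y fun i => inf_le_right
  refine ⟨x', y', hx', hy', fun i => ?_⟩
  rw [hx, hy]
  exact abs_sub_trunc_inf_abs_sub_trunc (x i) (y i)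

/-! ### The norm on the complexification of an ultraproduct -/

/-- The limit along the ultrafilter of the norms of the complexifications. -/
noncomputable def limCnorm (v : Complexification (Ultraproduct U B)) : ℝ :=
  limUnder (U : Filter I) fun i => (B i).cnorm ⟨rep v.re i, rep v.im i⟩

theorem tendsto_cnorm (x y : BoundedFamily B) :
    Tendsto (fun i => (B i).cnorm ⟨x i, y i⟩) U (𝓝 (limCnorm ⟨mk U x, mk U y⟩)) := by
  have h1 := tendsto_limUnder_of_bounded U
    (f := fun i => (B i).cnorm ⟨rep (mk U x) i, rep (mk U y) i⟩)
    (C := ‖rep (mk U x)‖ + ‖rep (mk U y)‖) fun i => by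
      rw [abs_of_nonneg (apply_nonneg _ _)]
      exact ((B i).cnorm_le _ _).trans (add_le_add (norm_apply_le _ i) (norm_apply_le _ i))
  have h2 : Tendsto (fun i => (B i).cnorm ⟨x i, y i⟩ -
      (B i).cnorm ⟨rep (mk U x) i, rep (mk U y) i⟩) U (𝓝 0) := by
    refine squeeze_zero_norm (a := fun i => ‖rep (mk U x) i - x i‖ + ‖rep (mk U y) i - y i‖)
      (fun i => ?_) (by simpa using (tendsto_rep_mk x).add (tendsto_rep_mk y))
    rw [norm_sub_rev, Real.norm_eq_abs]
    exact (B i).abs_cnorm_sub_le _ _ _ _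
  have h3 := h2.add h1
  simp only [sub_add_cancel, zero_add] at h3
  exact h3

theorem limCnorm_eq {x y : BoundedFamily B} {l : ℝ}
    (h : Tendsto (fun i => (B i).cnorm ⟨x i, y i⟩) U (𝓝 l)) : limCnorm ⟨mk U x, mk U y⟩ = l :=
  tendsto_nhds_unique (tendsto_cnorm x y) h

variable (U B) in
/-- The ultraproduct of abstract complex `L^p` spaces.  The norm of the complexification is definite
because it is bounded below by a multiple of the norms of the real and the imaginary part that does
not depend on the space. -/
noncomputable def space (hp : 0 < p) :
    AbstractComplexLp.{u} p where
  carrier := Ultraproduct U B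
  norm_add_rpow a b h := by
    obtain ⟨x, y, rfl, rfl, hxy⟩ := exists_disjoint_rep h
    have h1 := (tendsto_norm (U := U) (x + y)).rpow_const (p := p) (Or.inr hp.le)
    have h2 := ((tendsto_norm (U := U) x).rpow_const (p := p) (Or.inr hp.le)).add
      ((tendsto_norm (U := U) y).rpow_const (p := p) (Or.inr hp.le))
    exact tendsto_nhds_unique h1 (h2.congr fun i =>
      ((B i).norm_add_rpow (x i) (y i) (hxy i)).symm)
  cnorm := Seminorm.of limCnorm
    (fun v w => by
      obtain ⟨a, b⟩ := v
      obtain ⟨c, d⟩ := w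
      obtain ⟨x, rfl⟩ := mk_surjective U B a
      obtain ⟨y, rfl⟩ := mk_surjective U B b
      obtain ⟨x', rfl⟩ := mk_surjective U B c
      obtain ⟨y', rfl⟩ := mk_surjective U B d
      exact le_of_tendsto_of_tendsto' (tendsto_cnorm (U := U) (x + x') (y + y'))
        ((tendsto_cnorm x y).add (tendsto_cnorm x' y'))
        fun i => map_add_le_add (B i).cnorm ⟨x i, y i⟩ ⟨x' i, y' i⟩)
    (fun c v => by
      obtain ⟨a, b⟩ := v
      obtain ⟨x, rfl⟩ := mk_surjective U B a
      obtain ⟨y, rfl⟩ := mk_surjective U B b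
      refine limCnorm_eq (x := c.re • x - c.im • y) (y := c.im • x + c.re • y) ?_
      exact ((tendsto_cnorm x y).const_mul ‖c‖).congr fun i =>
        (map_smul_eq_mul (B i).cnorm c ⟨x i, y i⟩).symm)
  cnorm_definite v hv := by
    obtain ⟨a, b⟩ := v
    obtain ⟨x, rfl⟩ := mk_surjective U B a
    obtain ⟨y, rfl⟩ := mk_surjective U B b
    have h0 := (tendsto_cnorm (U := U) x y).const_mul (4 : ℝ)
    rw [show limCnorm ⟨mk U x, mk U y⟩ = 0 from hv, mul_zero] at h0
    have hx : mk U x = 0 := (Submodule.Quotient.mk_eq_zero _).2 (squeeze_zero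
      (fun i => norm_nonneg _) (fun i => (B i).norm_re_le_cnorm hp (x i) (y i)) h0)
    have hy : mk U y = 0 := (Submodule.Quotient.mk_eq_zero _).2 (squeeze_zero
      (fun i => norm_nonneg _) (fun i => (B i).norm_im_le_cnorm hp (x i) (y i)) h0)
    exact Complexification.ext hx hy
  norm_eq_cnorm a := by
    obtain ⟨x, rfl⟩ := mk_surjective U B a
    refine (limCnorm_eq (x := x) (y := 0) ?_).symm
    exact (tendsto_norm x).congr fun i => (B i).norm_eq_cnorm (x i)
  cnorm_rpow a b h α β := by
    obtain ⟨x, y, rfl, rfl, hxy⟩ := exists_disjoint_rep h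
    have h1 := (tendsto_cnorm (U := U) (α.re • x - α.im • (0 : BoundedFamily B) +
      (β.re • y - β.im • (0 : BoundedFamily B))) (α.im • x + α.re • (0 : BoundedFamily B) +
      (β.im • y + β.re • (0 : BoundedFamily B)))).rpow_const (p := p) (Or.inr hp.le)
    have h2 := (((tendsto_norm (U := U) x).rpow_const (p := p) (Or.inr hp.le)).const_mul
      (‖α‖ ^ p)).add (((tendsto_norm (U := U) y).rpow_const (p := p) (Or.inr hp.le)).const_mul
      (‖β‖ ^ p))
    exact tendsto_nhds_unique h1 (h2.congr fun i =>
      ((B i).cnorm_rpow (x i) (y i) (hxy i) α β).symm)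

end Ultraproduct

end AbstractComplexLp

/-! ### Isomorphisms of unit balls -/

namespace AbstractComplexLp

open Filter Topology ContLogic LatticeTruncation

variable {p : ℝ}

namespace Iso

variable {B₀ B₁ : AbstractComplexLp.{u} p}

/-- The underlying order isomorphism. -/
def toOrderIso (e : Iso B₀ B₁) : B₀.carrier ≃o B₁.carrier where
  toEquiv := e.toEquiv.toEquiv
  map_rel_iff' := e.map_le_map_iff _ _

theorem map_inf (e : Iso B₀ B₁) (x y : B₀.carrier) :
    e.toEquiv (x ⊓ y) = e.toEquiv x ⊓ e.toEquiv y :=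
  e.toOrderIso.map_inf x y

theorem map_abs (e : Iso B₀ B₁) (x : B₀.carrier) : e.toEquiv |x| = |e.toEquiv x| := by
  rw [abs, abs, ← map_neg]
  exact e.toOrderIso.map_sup x (-x)

/-- The restriction of an isomorphism to the unit balls. -/
def ballIso (e : Iso B₀ B₁) :
    Interpretation.Iso B₀.unitBallInterpretation B₁.unitBallInterpretation where
  toFun x := (⟨e.toEquiv x.val, (e.norm_map _).trans_le x.norm_le_one⟩ : UnitBall B₁)
  isometry := Isometry.of_dist_eq fun x y => by
    change min ‖e.toEquiv x.val - e.toEquiv y.val‖ 1 = min ‖x.val - y.val‖ 1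
    rw [← map_sub, e.norm_map]
  map_fn f x := by
    refine UnitBall.ext ?_
    cases f with
    | lin s t h =>
      change e.toEquiv (s • (x 0).val + t • (x 1).val) = _
      rw [map_add, map_smul, map_smul]
      rfl
    | meet s t h =>
      change e.toEquiv ((s • (x 0).val) ⊓ (t • (x 1).val)) = _
      rw [e.map_inf, map_smul, map_smul]
      rfl
    | abs => exact e.map_abs (x 0).val
  map_rel R x := by
    refine Subtype.ext ?_
    cases R with
    | norm => exact (e.norm_map (x 0).val).symm
    | cnorm => exact congrArg (min · 1) (e.cnorm_map (x 0).val (x 1).val).symm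
  map_const c := UnitBall.ext (map_zero e.toEquiv)
  surjective y := by
    refine ⟨⟨e.toEquiv.symm y.val, ?_⟩, UnitBall.ext (e.toEquiv.apply_symm_apply y.val)⟩
    rw [← e.norm_map, e.toEquiv.apply_symm_apply]
    exact y.norm_le_one

end Iso

namespace BallIso

variable {B₀ B₁ : AbstractComplexLp.{u} p}

theorem exists_eq_smul (B : AbstractComplexLp.{u} p) (x y : B.carrier) :
    ∃ (r : ℝ) (z w : UnitBall B), 0 < r ∧ x = r • z.val ∧ y = r • w.val ∧
      ‖z.val‖ ≤ 1 / 2 ∧ ‖w.val‖ ≤ 1 / 2 := by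
  have hx := norm_nonneg x
  have hy := norm_nonneg y
  set r := 2 * (‖x‖ + ‖y‖ + 1) with hr
  have hr0 : 0 < r := by linarith
  have key : ∀ v : B.carrier, ‖v‖ ≤ ‖x‖ + ‖y‖ → ‖r⁻¹ • v‖ ≤ 1 / 2 := fun v hv => by
    rw [norm_smul, norm_inv, Real.norm_of_nonneg hr0.le, inv_mul_le_iff₀ hr0]
    linarith
  have h1 := key x (by linarith)
  have h2 := key y (by linarith)
  refine ⟨r, ⟨r⁻¹ • x, by linarith⟩, ⟨r⁻¹ • y, by linarith⟩, hr0, ?_, ?_, h1, h2⟩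
  · exact (smul_inv_smul₀ hr0.ne' x).symm
  · exact (smul_inv_smul₀ hr0.ne' y).symm

variable (φ : Interpretation.Iso B₀.unitBallInterpretation B₁.unitBallInterpretation)

/-- An isomorphism of the interpretations, as a map of unit balls. -/
def ballMap : UnitBall B₀ → UnitBall B₁ := φ.toFun

theorem ballMap_lin {s t : ℝ} (h : |s| + |t| ≤ 1) (z w v : UnitBall B₀)
    (hv : v.val = s • z.val + t • w.val) :
    (ballMap φ v).val = s • (ballMap φ z).val + t • (ballMap φ w).val := by
  have h1 : v = B₀.ballFn (.lin s t h) ![z, w] := UnitBall.ext hv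
  rw [h1]
  exact congrArg UnitBall.val (φ.map_fn (LpLanguage.Fun.lin s t h) ![z, w])

theorem ballMap_meet {s t : ℝ} (h : |s| + |t| ≤ 1) (z w v : UnitBall B₀)
    (hv : v.val = (s • z.val) ⊓ (t • w.val)) :
    (ballMap φ v).val = (s • (ballMap φ z).val) ⊓ (t • (ballMap φ w).val) := by
  have h1 : v = B₀.ballFn (.meet s t h) ![z, w] := UnitBall.ext hv
  rw [h1]
  exact congrArg UnitBall.val (φ.map_fn (LpLanguage.Fun.meet s t h) ![z, w])

theorem norm_ballMap (z : UnitBall B₀) : ‖(ballMap φ z).val‖ = ‖z.val‖ :=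
  (congrArg Subtype.val (φ.map_rel LpLanguage.Rel.norm ![z])).symm

theorem min_cnorm_ballMap (z w : UnitBall B₀) :
    min (B₁.cnorm ⟨(ballMap φ z).val, (ballMap φ w).val⟩) 1 =
      min (B₀.cnorm ⟨z.val, w.val⟩) 1 :=
  (congrArg Subtype.val (φ.map_rel LpLanguage.Rel.cnorm ![z, w])).symm

/-- The extension of an isomorphism of unit balls to the whole spaces, by means of a chosen way of
writing an element as a multiple of an element of the unit ball; the choice does not matter. -/
noncomputable def extend (x : B₀.carrier) : B₁.carrier :=
  (exists_eq_smul B₀ x x).choose •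
    (ballMap φ (exists_eq_smul B₀ x x).choose_spec.choose).val

theorem smul_ballMap_eq {r r' : ℝ} (hr : 0 < r) (hr' : 0 < r') {z z' : UnitBall B₀}
    (h : r • z.val = r' • z'.val) : r • (ballMap φ z).val = r' • (ballMap φ z').val := by
  -- Both elements are contracted to the same element of the unit ball.
  have hR : 0 < r + r' := by linarith
  have ha : |r / (r + r')| + |(0 : ℝ)| ≤ 1 := by
    rw [abs_zero, add_zero, abs_of_nonneg (by positivity), div_le_one hR]; linarith
  have hb : |r' / (r + r')| + |(0 : ℝ)| ≤ 1 := by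
    rw [abs_zero, add_zero, abs_of_nonneg (by positivity), div_le_one hR]; linarith
  have e1 := ballMap_lin φ ha z z (B₀.ballFn (.lin _ _ ha) ![z, z]) rfl
  have e2 := ballMap_lin φ hb z' z' (B₀.ballFn (.lin _ _ ha) ![z, z]) (by
    change (r / (r + r')) • z.val + (0 : ℝ) • z.val = _
    rw [zero_smul, add_zero, zero_smul, add_zero, div_eq_inv_mul, mul_smul, h, div_eq_inv_mul,
      mul_smul])
  rw [zero_smul, add_zero] at e1 e2
  have e3 := congrArg (fun v => (r + r') • v) (e1.symm.trans e2)
  simpa only [smul_smul, mul_div_cancel₀ _ hR.ne'] using e3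

/-- The extension is `r z ↦ r φ(z)`, for every way of writing an element as a multiple of an element
of the unit ball. -/
theorem extend_smul {r : ℝ} (hr : 0 < r) (z : UnitBall B₀) :
    extend φ (r • z.val) = r • (ballMap φ z).val := by
  obtain ⟨w, h0, h1, -⟩ := (exists_eq_smul B₀ (r • z.val) (r • z.val)).choose_spec.choose_spec
  exact (smul_ballMap_eq φ hr h0 h1).symm

theorem extend_add (x y : B₀.carrier) : extend φ (x + y) = extend φ x + extend φ y := by
  obtain ⟨r, z, w, hr, rfl, rfl, -, -⟩ := exists_eq_smul B₀ x y
  have h : |(1 / 2 : ℝ)| + |(1 / 2 : ℝ)| ≤ 1 := by norm_num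
  set v := B₀.ballFn (.lin _ _ h) ![z, w] with hv
  have hv' : v.val = (1 / 2 : ℝ) • z.val + (1 / 2 : ℝ) • w.val := rfl
  have h1 : r • z.val + r • w.val = (2 * r) • v.val := by rw [hv']; module
  rw [h1, extend_smul φ (by linarith), extend_smul φ hr, extend_smul φ hr,
    ballMap_lin φ h z w v hv']
  module

theorem extend_real_smul (c : ℝ) (x : B₀.carrier) : extend φ (c • x) = c • extend φ x := by
  obtain ⟨r, z, -, hr, rfl, -, -, -⟩ := exists_eq_smul B₀ x x
  have hc : 0 < |c| + 1 := by positivity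
  have h : |c / (|c| + 1)| + |(0 : ℝ)| ≤ 1 := by
    rw [abs_zero, add_zero, abs_div, abs_of_pos hc, div_le_one hc]; linarith
  set v := B₀.ballFn (.lin _ _ h) ![z, z] with hv
  have hv' : v.val = (c / (|c| + 1)) • z.val + (0 : ℝ) • z.val := rfl
  have e : r * (|c| + 1) * (c / (|c| + 1)) = c * r := by field_simp
  have h1 : c • r • z.val = (r * (|c| + 1)) • v.val := by
    rw [hv', zero_smul, add_zero, smul_smul, smul_smul, e]
  rw [h1, extend_smul φ (by positivity), extend_smul φ hr, ballMap_lin φ h z z v hv', zero_smul,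
    add_zero, smul_smul, smul_smul, e]

theorem extend_inf (x y : B₀.carrier) : extend φ (x ⊓ y) = extend φ x ⊓ extend φ y := by
  obtain ⟨r, z, w, hr, rfl, rfl, -, -⟩ := exists_eq_smul B₀ x y
  have h : |(1 / 2 : ℝ)| + |(1 / 2 : ℝ)| ≤ 1 := by norm_num
  have hr2 : 0 < 2 * r := by linarith
  set v := B₀.ballFn (.meet _ _ h) ![z, w] with hv
  have hv' : v.val = ((1 / 2 : ℝ) • z.val) ⊓ ((1 / 2 : ℝ) • w.val) := rfl
  have e : 2 * r * (1 / 2) = r := by ring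
  have h1 : (r • z.val) ⊓ (r • w.val) = (2 * r) • v.val := by
    rw [hv', smul_inf hr2, smul_smul, smul_smul, e]
  rw [h1, extend_smul φ hr2, extend_smul φ hr, extend_smul φ hr, ballMap_meet φ h z w v hv',
    smul_inf hr2, smul_smul, smul_smul, e]

theorem norm_extend (x : B₀.carrier) : ‖extend φ x‖ = ‖x‖ := by
  obtain ⟨r, z, -, hr, rfl, -, -, -⟩ := exists_eq_smul B₀ x x
  rw [extend_smul φ hr, norm_smul, norm_smul, norm_ballMap]

theorem extend_surjective : Function.Surjective (extend φ) := by
  intro y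
  obtain ⟨r, z, -, hr, rfl, -, -, -⟩ := exists_eq_smul B₁ y y
  obtain ⟨w, hw⟩ := φ.surjective z
  exact ⟨r • w.val, (extend_smul φ hr w).trans (congrArg (fun v : UnitBall B₁ => r • v.val) hw)⟩

theorem cnorm_smul_smul (B : AbstractComplexLp.{u} p) {r : ℝ} (hr : 0 < r) (x y : B.carrier) :
    B.cnorm ⟨r • x, r • y⟩ = r * B.cnorm ⟨x, y⟩ := by
  have h : (⟨r • x, r • y⟩ : Complexification B.carrier) = (r : ℂ) • ⟨x, y⟩ := by
    ext
    · rw [Complexification.smul_re, Complex.ofReal_re, Complex.ofReal_im, zero_smul, sub_zero]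
    · rw [Complexification.smul_im, Complex.ofReal_re, Complex.ofReal_im, zero_smul, zero_add]
  rw [h, map_smul_eq_mul, Complex.norm_real, Real.norm_of_nonneg hr.le]

theorem cnorm_extend (x y : B₀.carrier) :
    B₁.cnorm ⟨extend φ x, extend φ y⟩ = B₀.cnorm ⟨x, y⟩ := by
  obtain ⟨r, z, w, hr, rfl, rfl, hz, hw⟩ := exists_eq_smul B₀ x y
  -- The representatives are so small that the truncation at `1` is not felt.
  have h1 := min_cnorm_ballMap φ z w
  have h2 := B₀.cnorm_le z.val w.val
  have h3 := B₁.cnorm_le (ballMap φ z).val (ballMap φ w).val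
  rw [norm_ballMap, norm_ballMap] at h3
  rw [min_eq_left (by linarith), min_eq_left (by linarith)] at h1
  rw [extend_smul φ hr, extend_smul φ hr, cnorm_smul_smul B₁ hr, cnorm_smul_smul B₀ hr, h1]

/-- The extension, as a linear map. -/
noncomputable def extendLinear : B₀.carrier →ₗ[ℝ] B₁.carrier where
  toFun := extend φ
  map_add' := extend_add φ
  map_smul' := extend_real_smul φ

theorem extend_injective : Function.Injective (extend φ) := by
  refine (injective_iff_map_eq_zero (extendLinear φ)).2 fun x hx => ?_
  rw [← norm_eq_zero, ← norm_extend φ x, norm_eq_zero]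
  exact hx

/-- An isomorphism of the unit balls extends to an isomorphism of abstract complex `L^p` spaces. -/
noncomputable def toIso : Iso B₀ B₁ where
  toEquiv := LinearEquiv.ofBijective (extendLinear φ) ⟨extend_injective φ, extend_surjective φ⟩
  map_le_map_iff x y := by
    change extend φ x ≤ extend φ y ↔ x ≤ y
    rw [← inf_eq_left, ← extend_inf, (extend_injective φ).eq_iff, inf_eq_left]
  norm_map := norm_extend φ
  cnorm_map := cnorm_extend φ

end BallIso

/-! ### The embedding of a model into the unit ball of an ultraproduct -/

section Embedding

open LpLanguage BoundedFamily

variable {I : Type u} {U : Ultrafilter I} {B : I → AbstractComplexLp.{u} p}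

theorem tendsto_norm_sub_of_tendsto_dist {a b : ∀ i, UnitBall (B i)}
    (h : Tendsto (fun i => dist (a i) (b i)) U (𝓝 0)) :
    Tendsto (fun i => ‖(a i).val - (b i).val‖) U (𝓝 0) := by
  refine h.congr' ?_
  filter_upwards [h.eventually_lt_const zero_lt_one] with i hi
  rw [UnitBall.dist_def] at hi ⊢
  exact min_eq_left (le_of_not_ge fun h1 => by rw [min_eq_right h1] at hi; exact lt_irrefl _ hi)

/-- A family in the unit balls, as a bounded family. -/
noncomputable def ballFamily (a : ∀ i, UnitBall (B i)) : BoundedFamily B :=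
  ofBound (fun i => (a i).val) 1 fun i => (a i).norm_le_one

variable (U) in
/-- A family in the unit balls defines an element of the unit ball of the ultraproduct. -/
noncomputable def ballClass (hp : 0 < p) (a : ∀ i, UnitBall (B i)) :
    UnitBall (Ultraproduct.space U B hp) where
  val := Ultraproduct.mk U (ballFamily a)
  norm_le_one := le_of_tendsto' (Ultraproduct.tendsto_norm (U := U) (ballFamily a))
    fun i => (a i).norm_le_one

theorem ballClass_eq {hp : 0 < p} {a b : ∀ i, UnitBall (B i)}
    (h : Tendsto (fun i => dist (a i) (b i)) U (𝓝 0)) : ballClass U hp a = ballClass U hp b :=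
  UnitBall.ext (Ultraproduct.mk_eq_mk.2 (tendsto_norm_sub_of_tendsto_dist h))

theorem tendsto_dist_ballClass (hp : 0 < p) (a b : ∀ i, UnitBall (B i)) :
    Tendsto (fun i => dist (a i) (b i)) U (𝓝 (dist (ballClass U hp a) (ballClass U hp b))) :=
  (Ultraproduct.tendsto_norm (U := U) (ballFamily a - ballFamily b)).min
    (tendsto_const_nhds (x := (1 : ℝ)))

theorem ballFn_ballClass (hp : 0 < p) {n : ℕ} (f : LpLanguage.Fun n)
    (a : Fin n → ∀ i, UnitBall (B i)) :
    (Ultraproduct.space U B hp).ballFn f (fun j => ballClass U hp (a j)) =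
      ballClass U hp fun i => (B i).ballFn f fun j => a j i := by
  refine UnitBall.ext ?_
  cases f with
  | lin s t h => rfl
  | meet s t h => exact Ultraproduct.mk_inf (U := U) (s • ballFamily (a 0)) (t • ballFamily (a 1))
  | abs => exact Ultraproduct.abs_mk (U := U) (ballFamily (a 0))

theorem tendsto_ballRel_ballClass (hp : 0 < p) {n : ℕ} (R : LpLanguage.Rel n)
    (a : Fin n → ∀ i, UnitBall (B i)) :
    Tendsto (fun i => ((B i).ballRel R fun j => a j i : ℝ)) U
      (𝓝 ((Ultraproduct.space U B hp).ballRel R fun j => ballClass U hp (a j))) := by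
  cases R with
  | norm => exact Ultraproduct.tendsto_norm (ballFamily (a 0))
  | cnorm =>
    exact (Ultraproduct.tendsto_cnorm (ballFamily (a 0)) (ballFamily (a 1))).min
      (tendsto_const_nhds (x := (1 : ℝ)))

/-- If all formulas are preserved in the limit by maps of `M` to the unit balls of the `B i`, then
the classes of these maps embed `M` into the unit ball of the ultraproduct. -/
theorem nonempty_embedding_of_tendsto_value (hp : 0 < p) {M : Interpretation.{u} langLpC}
    (g : ∀ i, M.carrier → UnitBall (B i))
    (hg : ∀ (k : ℕ) (ψ : Formula langLpC k) (a : Fin k → M.carrier),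
      Tendsto (fun i => ((B i).unitBallInterpretation.value ψ (g i ∘ a) : ℝ)) U
        (𝓝 (M.value ψ a : ℝ))) :
    Nonempty (Interpretation.Embedding M (Ultraproduct.space U B hp).unitBallInterpretation) := by
  refine ⟨⟨fun x => ballClass U hp fun i => g i x, ?_, ?_, ?_, ?_⟩⟩
  · refine Isometry.of_dist_eq fun x y => ?_
    exact tendsto_nhds_unique (tendsto_dist_ballClass hp _ _)
      (hg 2 (.dist (.var 0) (.var 1)) ![x, y])
  · intro n f x
    obtain ⟨a, ha, ha'⟩ : ∃ a : Fin (n + 1) → M.carrier,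
        (∀ j, a j.castSucc = x j) ∧ a (Fin.last n) = M.fn f x :=
      ⟨Fin.snoc x (M.fn f x), fun j => Fin.snoc_castSucc .., Fin.snoc_last ..⟩
    have h1 : Tendsto (fun i => dist ((B i).ballFn f fun j => g i (a j.castSucc))
        (g i (a (Fin.last n)))) U
          (𝓝 (dist (M.fn f fun j => a j.castSucc) (a (Fin.last n)))) :=
      hg (n + 1) (.dist (.app f fun j => .var j.castSucc) (.var (Fin.last n))) a
    simp only [ha, ha', dist_self] at h1
    exact (ballClass_eq h1).symm.trans (ballFn_ballClass hp f fun j i => g i (x j)).symm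
  · intro n R x
    exact Subtype.ext (tendsto_nhds_unique (hg n (.rel R fun j => .var j) x)
      (tendsto_ballRel_ballClass hp R fun j i => g i (x j)))
  · intro c
    have h1 := hg 1 (.dist (.const c) (.var 0)) ![M.const c]
    simp only [Interpretation.value, Interpretation.termValue,
      Matrix.cons_val_zero, dist_self] at h1
    exact (ballClass_eq h1).symm

end Embedding

end AbstractComplexLp

theorem theorem14 (p : ℝ) (hp : 1 ≤ p) :
    ∃ T : ContLogic.Theory LpLanguage.langLpC,
      ContLogic.Represents (AbstractComplexLp.IsIso.{u} (p := p)) T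
        (fun B : AbstractComplexLp.{u} p => B.unitBallInterpretation) := by
  have hp0 : 0 < p := zero_lt_one.trans_le hp
  refine ⟨ContLogic.theoryOf fun B : AbstractComplexLp.{u} p => B.unitBallInterpretation,
    fun B φ hφ => hφ B, fun B₀ B₁ => ⟨fun ⟨e⟩ => ⟨e.ballIso⟩,
      fun ⟨φ⟩ => ⟨AbstractComplexLp.BallIso.toIso φ⟩⟩, fun M hM => ?_⟩
  obtain ⟨I, U, B, g, hg⟩ := ContLogic.exists_tendsto_value hM
  exact ⟨AbstractComplexLp.Ultraproduct.space U B hp0,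
    AbstractComplexLp.nonempty_embedding_of_tendsto_value hp0 g hg⟩
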